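/- **Notation.** Let $d\ge 0$ be an integer and $\mathcal P_2(\mathbb R^d)$ the set of Borel probability measures on $\mathbb R^d$ with finite second moment. For $\mu\in\mathcal P_2(\mathbb R^d)$ and $\xi\in L^2(\mathbb R^d;\mu)$ (vector fields $\mathbb R^d\to\mathbb R^d$), $\xi_\#\mu$ is the push-forward. A function $\phi:\mathcal P_2(\mathbb R^d)\to\mathbb R$ is called *Wasserstein differentiable* at $\mu$, with Wasserstein gradient $\nabla_{\mathbf W}\phi(\mu,\cdot)=\zeta\in L^2(\mathbb R^d;\mu)$, if $\zeta$ lies in its (strong) Fréchet sub- and superdifferential at $\mu$, that is, if $$\phi(\nu)-\phi(\mu)=\iint\langle \zeta(x),y-x\rangle\,d\gamma(x,y)+o\Big(\big(\textstyle\iint|x-y|^2d\gamma\big)^{1/2}\Big)$$ uniformly over all $\nu\in\mathcal P_2(\mathbb R^d)$ and all couplings $\gamma$ of $\mu$ and $\nu$; such a $\zeta$ is unique $\mu$-a.e. **Assumptions.** Fix $\rho_0\in\mathcal P_2(\mathbb R^d)$, $\mathbb H:=L^2(\mathbb R^d;\rho_0)$, $\phi:\mathcal P_2(\mathbb R^d)\to\mathbb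 R$ and $\lambda\in\mathbb R$. Let the lift $\phi^\#_{\rho_0}(\xi):=\phi(\xi_\#\rho_0)$ be Fréchet differentiable on $\mathbb H$, bounded below on $\mathbb H$, and $\lambda$-convex: $$\phi^\#_{\rho_0}((1-t)\xi_1+t\xi_2)\le(1-t)\phi^\#_{\rho_0}(\xi_1)+t\phi^\#_{\rho_0}(\xi_2)-\tfrac\lambda2t(1-t)\|\xi_1-\xi_2\|_{\mathbb H}^2,\qquad \xi_1,\xi_2\in\mathbb H,\ t\in[0,1].$$ Assume that $\rho_0$ has no atoms or, if it has atoms, that $\phi$ is Wasserstein differentiable at $\xi_\#\rho_0$ for every $\xi\in\mathbb H$. For every $\tau>0$ with $\lambda/2+1/\tau>0$ let $(X^\tau_n)_{n\ge0}\subset\mathbb H$ be iterates of the Lagrangian trapezoidal scheme, $$X^\tau_{n+1}\in\operatorname*{arg\,min}_{\xi\in\mathbb H}\Big\{\tfrac12\big(\phi^\#_{\rho_0}(\xi)+\langle\nabla\phi^\#_{\rho_0}(X^\tau_n),\xi\rangle_{\mathbb H}\big)+\tfrac1{2\tau}\|\xi-X^\tau_n\|_{\mathbb H}^2\Big\},\qquad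 n\ge 0,$$ with initial iterates satisfying $\lim_{\tau\downarrow0}\|X^\tau_0-\mathrm{Id}\|_{\mathbb H}=0$ and $\sup_{\tau}\|\nabla\phi^\#_{\rho_0}(X^\tau_0)\|_{\mathbb H}<\infty$, the supremum being over all such $\tau$. Put $\underline X^\tau_t:=X^\tau_n$ for $t\in[n\tau,(n+1)\tau)$. **Theorem.** There is a curve $X:[0,\infty)\to\mathbb H$ with $\underline X^\tau_t\to X(t)$ in $\mathbb H$ as $\tau\downarrow0$, uniformly for $t\in[0,T]$, for every $T>0$. With $\rho_t:=X(t)_\#\rho_0$, the function $\phi$ is Wasserstein differentiable at $\rho_t$ for every $t\ge0$, and $(\rho_t)_{t\ge0}$ is a weak solution of $$\partial_t\rho-\nabla\cdot\big(\rho\,\nabla_{\mathbf W}\phi(\rho,x)\big)=0\ \text{ on }(0,\infty)\times\mathbb R^d,\qquad \rho(0,\cdot)=\rho_0 .$$ Here weak solution means: $\rho_t|_{t=0}=\rho_0$; with $v_t:=-\nabla_{\mathbf W}\phi(\rho_t,\cdot)$ one has $v_t\in L^1(\rho_t)$ for a.e. $t>0$ and $t\mapsto\int|v_t|\,d\rho_t$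 is integrable on $(0,T)$ for every $T>0$; and for every $\psi\in C^1_c(\mathbb R^d)$ the function $t\mapsto\int\psi\,d\rho_t$ is absolutely continuous on $[0,T]$ for every $T>0$, with $\frac{d}{dt}\int\psi\,d\rho_t=\int\langle\nabla\psi,v_t\rangle\,d\rho_t$ for a.e. $t>0$. -/

import Mathlib

open MeasureTheory Set Filter Topology
open scoped ENNReal

noncomputable section

namespace TrapezoidFlow

/-- The Euclidean space of dimension `d`. -/
abbrev Euc (d : ℕ) : Type := EuclideanSpace ℝ (Fin d)

/-- Borel probability measures on Euclidean space with finite second moment. -/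
@[ext]
structure P2 (d : ℕ) where
  meas : Measure (Euc d)
  isProb : IsProbabilityMeasure meas
  memLp : MemLp (fun x : Euc d => x) 2 meas

instance {d : ℕ} (μ : P2 d) : IsProbabilityMeasure μ.meas := μ.isProb

/-- The Hilbert space of square integrable vector fields with respect to `μ`. -/
abbrev HSpace {d : ℕ} (μ : P2 d) : Type := Lp (Euc d) 2 μ.meas

/-- The identity map, as an element of the Hilbert space. -/
def idMap {d : ℕ} (μ : P2 d) : HSpace μ := MemLp.toLp (fun x : Euc d => x) μ.memLp

/-- The push-forward of `μ` by a square integrable map. -/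
def push {d : ℕ} (μ : P2 d) (ξ : HSpace μ) : P2 d :=
  ⟨Measure.map ξ μ.meas,
    Measure.isProbabilityMeasure_map (Lp.aestronglyMeasurable ξ).aemeasurable,
    (memLp_map_measure_iff aestronglyMeasurable_id
      (Lp.aestronglyMeasurable ξ).aemeasurable).2 (Lp.memLp ξ)⟩

/-- The lift of `φ` by `μ`. -/
def lift {d : ℕ} (φ : P2 d → ℝ) (μ : P2 d) (ξ : HSpace μ) : ℝ := φ (push μ ξ)

/-- The transport plans with first marginal `μ` and second marginal `ν`. -/
def Plans {d : ℕ} (μ ν : P2 d) : Set (Measure (Euc d × Euc d)) :=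
  {γ | γ.fst = μ.meas ∧ γ.snd = ν.meas}

/-- The quadratic displacement of a plan: the square root of the integral of `|y - x|^2`. -/
def planDist {d : ℕ} (γ : Measure (Euc d × Euc d)) : ℝ :=
  Real.sqrt (∫ p, ‖p.2 - p.1‖ ^ 2 ∂γ)

/-- `ζ` belongs to the (strong) Fréchet subdifferential of `φ` at `μ`: for all transport plans
from `μ`, `φ ν - φ μ ≥ ∬ ⟨ζ x, y - x⟩ dγ - o(planDist γ)`. -/
def IsSubgradient {d : ℕ} (φ : P2 d → ℝ) (μ : P2 d) (ζ : Euc d → Euc d) : Prop :=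
  MemLp ζ 2 μ.meas ∧
    ∀ ε : ℝ, 0 < ε → ∃ δ : ℝ, 0 < δ ∧ ∀ ν : P2 d, ∀ γ ∈ Plans μ ν, planDist γ < δ →
      (∫ p, inner ℝ (ζ p.1) (p.2 - p.1) ∂γ) - ε * planDist γ ≤ φ ν - φ μ

/-- `ζ` belongs to the (strong) Fréchet superdifferential of `φ` at `μ`. -/
def IsSupergradient {d : ℕ} (φ : P2 d → ℝ) (μ : P2 d) (ζ : Euc d → Euc d) : Prop :=
  MemLp ζ 2 μ.meas ∧
    ∀ ε : ℝ, 0 < ε → ∃ δ : ℝ, 0 < δ ∧ ∀ ν : P2 d, ∀ γ ∈ Plans μ ν, planDist γ < δ →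
      φ ν - φ μ ≤ (∫ p, inner ℝ (ζ p.1) (p.2 - p.1) ∂γ) + ε * planDist γ

/-- `ζ` is the Wasserstein gradient of `φ` at `μ`: it lies both in the subdifferential and in the
superdifferential. Such a field is unique up to `μ`-null sets, as one sees by testing with the
plans carried by the graphs of the maps `x ↦ x + h η x`. -/
def IsWassersteinGradient {d : ℕ} (φ : P2 d → ℝ) (μ : P2 d) (ζ : Euc d → Euc d) : Prop :=
  IsSubgradient φ μ ζ ∧ IsSupergradient φ μ ζ

/-- Wasserstein differentiability of `φ` at `μ`. -/
def WassersteinDifferentiableAt {d : ℕ} (φ : P2 d → ℝ) (μ : P2 d) : Prop :=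
  ∃ ζ : Euc d → Euc d, IsWassersteinGradient φ μ ζ

open Classical in
/-- The Wasserstein gradient of `φ` at `μ` as a vector field (a representative of the unique class;
zero where `φ` is not Wasserstein differentiable). -/
def wassersteinGradient {d : ℕ} (φ : P2 d → ℝ) (μ : P2 d) : Euc d → Euc d :=
  if h : WassersteinDifferentiableAt φ μ then h.choose else 0

/-- `x` is a sequence of iterates of the Lagrangian trapezoidal scheme with time step `τ`:
`x (n + 1)` minimizes
`ξ ↦ (1/2) (lift ξ + ⟨∇ lift (x n), ξ⟩) + (1/(2τ)) ‖ξ - x n‖^2` over the Hilbert space. -/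
def IsTrapezoidalScheme {d : ℕ} (φ : P2 d → ℝ) (μ : P2 d) (τ : ℝ) (x : ℕ → HSpace μ) : Prop :=
  ∀ n : ℕ, IsMinOn (fun ξ : HSpace μ =>
      (1 / 2) * (lift φ μ ξ + inner ℝ (gradient (lift φ μ) (x n)) ξ)
        + (1 / (2 * τ)) * ‖ξ - x n‖ ^ 2)
    univ (x (n + 1))

/-- The piecewise constant interpolation: the value `x n` on `[n τ, (n + 1) τ)`. -/
def pcInterp {H : Type*} (τ : ℝ) (x : ℕ → H) (t : ℝ) : H := x ⌊t / τ⌋₊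

/-- Weak solutions on `[0, ∞)` of the continuity equation `∂ₜ ρ + ∇ · (ρ v) = 0` with initial
datum `ρ₀`. The velocities are integrable in space and locally integrable in time, and for each
continuously differentiable compactly supported test function `ψ`, the function `t ↦ ∫ ψ dρₜ` is
locally absolutely continuous on `[0, ∞)` with derivative `∫ ⟨∇ψ, vₜ⟩ dρₜ` for almost every
`t > 0`. -/
structure IsWeakSolution {d : ℕ} (ρ : ℝ → P2 d) (v : ℝ → Euc d → Euc d) (ρ₀ : P2 d) : Prop where
  initial : ρ 0 = ρ₀
  integrable : ∀ᵐ t ∂(volume.restrict (Ioi (0 : ℝ))), Integrable (v t) (ρ t).meas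
  time_integrable : ∀ T : ℝ, 0 < T →
    IntegrableOn (fun t : ℝ => ∫ x, ‖v t x‖ ∂(ρ t).meas) (Ioc 0 T) volume
  test_ac : ∀ ψ : Euc d → ℝ, ContDiff ℝ 1 ψ → HasCompactSupport ψ → ∀ T : ℝ, 0 < T →
    AbsolutelyContinuousOnInterval (fun t : ℝ => ∫ x, ψ x ∂(ρ t).meas) 0 T
  test_deriv : ∀ ψ : Euc d → ℝ, ContDiff ℝ 1 ψ → HasCompactSupport ψ →
    ∀ᵐ t ∂(volume.restrict (Ioi (0 : ℝ))),
      HasDerivAt (fun s : ℝ => ∫ x, ψ x ∂(ρ s).meas)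
        (∫ x, inner ℝ (gradient ψ x) (v t x) ∂(ρ t).meas) t

end TrapezoidFlow

end

/-!
# Convergence of the Lagrangian trapezoidal scheme

**The Hilbert space part.** Write `F` for the lift of `φ` and `A = ∇F`. Being differentiable and
`λ`-convex, `F` has a continuous gradient (`continuous_gradient_of_strongConvexOn`) which is
semi-monotone: `⟪A y - A x, y - x⟫ ≥ -|λ| ‖y - x‖²`. The minimization problem of the scheme is
equivalent to the trapezoidal rule `x (n + 1) = x n - (τ / 2) (A (x n) + A (x (n + 1)))`. Testing
semi-monotonicity with the increment shows that `‖A (x n)‖` stays bounded on bounded time intervals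
(`norm_sq_apply_le_of_isCrankNicolson`), so that the piecewise affine interpolations are uniformly
Lipschitz. The derivative of the interpolation is an average of values of `-A` at nodes
at distance `O(τ)`, hence a Gronwall argument for the squared distance of two interpolations with
steps `τ` and `σ` (`norm_sq_plInterp_sub_le`) gives a uniform Cauchy estimate. The limit solves
`X' = -A X` because `A` is continuous (`exists_flow_of_isCrankNicolson`).

**Wasserstein gradients.** Any Wasserstein gradient `ζ` at the law of `ξ` satisfies `ζ ∘ ξ = A ξ`
almost everywhere (`IsWassersteinGradient.hasGradientAt_lift`). Conversely, if `ρ₀` has no atoms,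
then the average `ζ` of `A ξ` over the fibres of `ξ` is a Wasserstein gradient. To see this, a plan
`γ` from the law of `ξ` to `ν` is glued to `ρ₀` so as to be independent of `A ξ` given `ξ`. As
`ρ₀` has no atoms, the resulting coupling can be approximated by the graph of a map `η` whose law is
exactly `ν` (`exists_map_prodMk_simpleFunc_eq`, `exists_push_eq_of_mem_plans`). Then
`‖η - ξ‖` is almost the displacement of `γ` and `⟪A ξ, η - ξ⟫` is almost `∬ ⟪ζ x, y - x⟫ dγ`, and
the Fréchet expansion of `F` at `ξ` becomes the Wasserstein expansion of `φ`.

**The continuity equation.** For a test function `ψ`, the functional `ξ ↦ ∫ ψ (ξ) dρ₀` is Lipschitz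
and satisfies the chain rule along differentiable curves (`hasDerivAt_integral_push`). Applied to
`X' = -A X = -ζ ∘ X` it yields the weak formulation, with a derivative at every positive time.
-/

namespace TrapezoidFlow

/-! ### Gradients of differentiable semi-convex functions -/

section Gradient

variable {H : Type*} [NormedAddCommGroup H] [InnerProductSpace ℝ H] [CompleteSpace H]

/-- The tangent inequality: a strongly convex function lies above its tangent paraboloids. -/
lemma inner_gradient_add_le_sub_of_strongConvexOn {F : H → ℝ} {lam : ℝ}
    (hd : Differentiable ℝ F) (hc : StrongConvexOn univ lam F) (x y : H) :
    inner ℝ (gradient F x) (y - x) + lam / 2 * ‖y - x‖ ^ 2 ≤ F y - F x := by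
  have hline : HasDerivAt (fun t : ℝ => F (x + t • (y - x)))
      (inner ℝ (gradient F x) (y - x)) 0 := by
    have h1 : HasFDerivAt F (InnerProductSpace.toDual ℝ H (gradient F x))
        (x + (0 : ℝ) • (y - x)) := by
      have := (hd x).hasGradientAt.hasFDerivAt
      simpa using this
    have h2 : HasDerivAt (fun t : ℝ => x + t • (y - x)) (y - x) 0 := by
      simpa using ((hasDerivAt_id (0 : ℝ)).smul_const (y - x)).const_add x
    simpa [Function.comp_def] using h1.comp_hasDerivAt (0 : ℝ) h2
  have h0 := hline.tendsto_slope_zero_right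
  have h1 : Tendsto (fun t : ℝ => F y - F x - lam / 2 * (1 - t) * ‖y - x‖ ^ 2) (𝓝[>] 0)
      (𝓝 (F y - F x - lam / 2 * (1 - 0) * ‖y - x‖ ^ 2)) := by
    refine Tendsto.mono_left (Continuous.tendsto (by fun_prop) 0) nhdsWithin_le_nhds
  have h2 := le_of_tendsto_of_tendsto h0 h1 (by
    filter_upwards [Ioo_mem_nhdsGT (zero_lt_one' ℝ)] with t ht
    have h3 := hc.2 (mem_univ x) (mem_univ y) (sub_nonneg.2 ht.2.le) ht.1.le (by ring)
    have h4 : (1 - t) • x + t • y = x + t • (y - x) := by module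
    rw [h4, norm_sub_rev] at h3
    simp only [smul_eq_mul, zero_add, zero_smul, add_zero] at h3 ⊢
    rw [inv_mul_le_iff₀ ht.1]
    nlinarith)
  linarith

/-- Semi-monotonicity of the gradient. The sign of `lam` is forgotten, since only a lower bound is
needed on bounded time intervals. -/
lemma neg_mul_sq_le_inner_gradient_sub {F : H → ℝ} {lam : ℝ}
    (hd : Differentiable ℝ F) (hc : StrongConvexOn univ lam F) (x y : H) :
    -|lam| * ‖y - x‖ ^ 2 ≤ inner ℝ (gradient F y - gradient F x) (y - x) := by
  have h1 := inner_gradient_add_le_sub_of_strongConvexOn hd hc x y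
  have h2 := inner_gradient_add_le_sub_of_strongConvexOn hd hc y x
  have h3 : inner ℝ (gradient F y) (x - y) = -inner ℝ (gradient F y) (y - x) := by
    rw [← inner_neg_right, neg_sub]
  rw [norm_sub_rev x y, h3] at h2
  rw [inner_sub_left]
  nlinarith [neg_abs_le lam, sq_nonneg ‖y - x‖]

lemma norm_le_of_forall_inner_le {E : Type*} [NormedAddCommGroup E] [InnerProductSpace ℝ E]
    {p : E} {r B : ℝ} (hr : 0 < r)
    (h : ∀ v : E, ‖v‖ = r → inner ℝ p v ≤ B * r) (hB : 0 ≤ B) : ‖p‖ ≤ B := by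
  by_cases hp : p = 0
  · simpa [hp] using hB
  have hp' : 0 < ‖p‖ := norm_pos_iff.2 hp
  have := h ((r / ‖p‖) • p) (by
    rw [norm_smul, Real.norm_of_nonneg (by positivity)]; field_simp)
  rw [inner_smul_right, real_inner_self_eq_norm_sq] at this
  have h2 : r / ‖p‖ * ‖p‖ ^ 2 = ‖p‖ * r := by field_simp
  rw [h2] at this
  exact le_of_mul_le_mul_right this hr

/-- A Fréchet differentiable semi-convex function is continuously differentiable: by convexity, the
remainder of the first-order expansion at `x` controls the variation of the gradient near `x`. -/
lemma continuous_gradient_of_strongConvexOn {F : H → ℝ} {lam : ℝ}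
    (hd : Differentiable ℝ F) (hc : StrongConvexOn univ lam F) : Continuous (gradient F) := by
  rw [continuous_iff_continuousAt]
  intro x
  rw [Metric.continuousAt_iff]
  intro ε hε
  have hF := (hd x).hasGradientAt.hasFDerivAt
  rw [hasFDerivAt_iff_isLittleO_nhds_zero, Asymptotics.isLittleO_iff] at hF
  have hF' := hF (c := ε / 8) (by positivity)
  rw [Metric.eventually_nhds_iff] at hF'
  obtain ⟨δ, hδ, hF'⟩ := hF'
  obtain ⟨r, hr, hr1, hr2⟩ : ∃ r : ℝ, 0 < r ∧ 2 * r < δ ∧ |lam| * r ≤ ε / 4 := by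
    refine ⟨min (δ / 4) (ε / 4 / (|lam| + 1)), by positivity, ?_, ?_⟩
    · linarith [min_le_left (δ / 4) (ε / 4 / (|lam| + 1))]
    · calc |lam| * min (δ / 4) (ε / 4 / (|lam| + 1)) ≤ (|lam| + 1) * (ε / 4 / (|lam| + 1)) := by
            gcongr
            · linarith
            · exact min_le_right _ _
        _ = ε / 4 := by field_simp
  refine ⟨r, hr, fun y hy => ?_⟩
  rw [dist_eq_norm] at hy ⊢
  -- Test the difference of the gradients with vectors `v` of length `r`, using tangent inequalities
  -- at `y` (towards `y + v`) and at `x` (towards `y`), and the expansion at `x` of `F (y + v)`.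
  refine lt_of_le_of_lt (norm_le_of_forall_inner_le hr (B := 3 * ε / 4) (fun v hv => ?_)
    (by positivity)) (by linarith)
  have h1 := inner_gradient_add_le_sub_of_strongConvexOn hd hc y (y + v)
  have h2 := inner_gradient_add_le_sub_of_strongConvexOn hd hc x y
  have h4 : ‖y - x + v‖ ≤ 2 * r := by
    have := norm_add_le (y - x) v
    linarith
  have h3 := hF' (y := y - x + v) (by rw [dist_zero_right]; linarith)
  have h5 : x + (y - x + v) = y + v := by abel
  rw [h5, InnerProductSpace.toDual_apply_apply, Real.norm_eq_abs] at h3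
  have h6 := (abs_le.1 h3).2
  rw [inner_add_right] at h6
  rw [add_sub_cancel_left, hv] at h1
  rw [inner_sub_left]
  have h7 : ε / 8 * ‖y - x + v‖ ≤ ε / 8 * (2 * r) := by gcongr
  have h8 : -|lam| * r ^ 2 ≤ lam * r ^ 2 := by gcongr; exact neg_abs_le lam
  have h9 : -|lam| * r ^ 2 ≤ lam * ‖y - x‖ ^ 2 := by
    have h10 : ‖y - x‖ ^ 2 ≤ r ^ 2 := by gcongr
    nlinarith [neg_abs_le lam, abs_nonneg lam, sq_nonneg ‖y - x‖]
  have h10 : |lam| * r ^ 2 ≤ ε / 4 * r := by nlinarith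
  nlinarith

/-- First-order optimality for one step of the trapezoidal scheme. -/
lemma eq_sub_of_isMinOn_trapezoidal {F : H → ℝ} (hd : Differentiable ℝ F) {τ : ℝ} (hτ : 0 < τ)
    {x z : H}
    (h : IsMinOn (fun ξ : H => (1 / 2) * (F ξ + inner ℝ (gradient F x) ξ)
        + (1 / (2 * τ)) * ‖ξ - x‖ ^ 2) univ z) :
    z = x - (τ / 2) • (gradient F x + gradient F z) := by
  have hgrad : HasFDerivAt (fun ξ : H => (1 / 2) * (F ξ + inner ℝ (gradient F x) ξ)
        + (1 / (2 * τ)) * ‖ξ - x‖ ^ 2)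
      ((1 / 2 : ℝ) • (InnerProductSpace.toDual ℝ H (gradient F z) + innerSL ℝ (gradient F x))
        + (1 / (2 * τ)) • (2 • (innerSL ℝ (z - x)).comp (ContinuousLinearMap.id ℝ H))) z := by
    refine HasFDerivAt.add (HasFDerivAt.const_mul (HasFDerivAt.add
      (hd z).hasGradientAt.hasFDerivAt (innerSL ℝ (gradient F x)).hasFDerivAt) _) ?_
    refine HasFDerivAt.const_mul ?_ _
    exact ((hasFDerivAt_id z).sub_const x).norm_sq
  have h0 := (IsMinOn.isLocalMin h univ_mem).hasFDerivAt_eq_zero hgrad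
  have h1 : ∀ v : H, inner ℝ ((1 / 2 : ℝ) • (gradient F z + gradient F x)
      + (1 / τ) • (z - x)) v = 0 := by
    intro v
    have := DFunLike.congr_fun h0 v
    simp only [add_apply, smul_apply,
      InnerProductSpace.toDual_apply_apply, innerSL_apply_apply, ContinuousLinearMap.comp_apply,
      ContinuousLinearMap.id_apply, smul_eq_mul, zero_apply,
      nsmul_eq_mul, Nat.cast_ofNat] at this
    rw [inner_add_left, real_inner_smul_left, real_inner_smul_left, inner_add_left]
    rw [← this]
    field_simp
  have h2 := inner_self_eq_zero.1 (h1 _)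
  have h3 : τ • ((1 / 2 : ℝ) • (gradient F z + gradient F x) + (1 / τ) • (z - x)) = 0 := by
    rw [h2, smul_zero]
  rw [smul_add, smul_smul, smul_smul, mul_one_div_cancel hτ.ne', one_smul] at h3
  rw [← sub_eq_zero, ← h3, show τ * (1 / 2) = τ / 2 by ring]
  module

end Gradient

/-! ### Piecewise affine interpolation -/

section Interpolation

variable {H : Type*} [NormedAddCommGroup H] [NormedSpace ℝ H]

/-- The continuous, piecewise affine interpolation with nodal values `x n` at the times `n τ`. -/
noncomputable def plInterp (τ : ℝ) (x : ℕ → H) (t : ℝ) : H :=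
  x ⌊t / τ⌋₊ + (t / τ - ⌊t / τ⌋₊) • (x (⌊t / τ⌋₊ + 1) - x ⌊t / τ⌋₊)

lemma plInterp_zero (τ : ℝ) (x : ℕ → H) : plInterp τ x 0 = x 0 := by simp [plInterp]

lemma plInterp_eq_of_mem_Icc {τ : ℝ} (hτ : 0 < τ) (x : ℕ → H) (n : ℕ) {t : ℝ}
    (ht : t ∈ Icc (n * τ) ((n + 1) * τ)) :
    plInterp τ x t = x n + (t / τ - n) • (x (n + 1) - x n) := by
  have h1 : (n : ℝ) ≤ t / τ := (le_div_iff₀ hτ).2 ht.1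
  rcases eq_or_lt_of_le ht.2 with h | h
  · have h2 : t / τ = ((n + 1 : ℕ) : ℝ) := by
      rw [h]; push_cast; field_simp
    have h3 : ((n + 1 : ℕ) : ℝ) - n = 1 := by push_cast; ring
    rw [plInterp, h2, Nat.floor_natCast, h3, sub_self]
    simp
  · have h2 : ⌊t / τ⌋₊ = n := (Nat.floor_eq_iff ((Nat.cast_nonneg n).trans h1)).2
      ⟨h1, (div_lt_iff₀ hτ).2 h⟩
    rw [plInterp, h2]

lemma continuousOn_plInterp {τ : ℝ} (hτ : 0 < τ) (x : ℕ → H) (T : ℝ) :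
    ContinuousOn (plInterp τ x) (Icc 0 T) := by
  have key : ∀ n : ℕ, ContinuousOn (plInterp τ x) (Icc 0 (n * τ)) := by
    intro n
    induction n with
    | zero => simp
    | succ n ih =>
      have h1 : ContinuousOn (plInterp τ x) (Icc (n * τ) ((n + 1) * τ)) := by
        refine ContinuousOn.congr (f := fun t => x n + (t / τ - n) • (x (n + 1) - x n)) ?_
          (fun t ht => plInterp_eq_of_mem_Icc hτ x n ht)
        fun_prop
      have h2 := ih.union_of_isClosed h1 isClosed_Icc isClosed_Icc
      rw [Icc_union_Icc_eq_Icc (by positivity) (by nlinarith)] at h2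
      exact_mod_cast h2
  refine (key ⌈T / τ⌉₊).mono (Icc_subset_Icc_right ?_)
  exact (div_le_iff₀ hτ).1 (Nat.le_ceil _)

lemma floor_mul_mem {τ : ℝ} (hτ : 0 < τ) {t : ℝ} (ht : 0 ≤ t) :
    t ∈ Ico (⌊t / τ⌋₊ * τ) ((⌊t / τ⌋₊ + 1) * τ) :=
  ⟨(le_div_iff₀ hτ).1 (Nat.floor_le (by positivity)),
    (div_lt_iff₀ hτ).1 (Nat.lt_floor_add_one _)⟩

lemma hasDerivWithinAt_plInterp {τ : ℝ} (hτ : 0 < τ) (x : ℕ → H) {t : ℝ} (ht : 0 ≤ t) :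
    HasDerivWithinAt (plInterp τ x) (τ⁻¹ • (x (⌊t / τ⌋₊ + 1) - x ⌊t / τ⌋₊)) (Ici t) t := by
  set n := ⌊t / τ⌋₊ with hn
  have hm := floor_mul_mem hτ ht
  rw [← hn] at hm
  have h1 : HasDerivAt (fun s : ℝ => x n + (s / τ - n) • (x (n + 1) - x n))
      (τ⁻¹ • (x (n + 1) - x n)) t := by
    have := ((((hasDerivAt_id t).div_const τ).sub_const (n : ℝ)).smul_const
      (x (n + 1) - x n)).const_add (x n)
    simpa using this
  refine h1.hasDerivWithinAt.congr_of_eventuallyEq ?_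
    (plInterp_eq_of_mem_Icc hτ x n (Ico_subset_Icc_self hm))
  filter_upwards [Ico_mem_nhdsGE hm.2] with s hs
  exact plInterp_eq_of_mem_Icc hτ x n ⟨hm.1.trans hs.1, hs.2.le⟩

lemma norm_plInterp_sub_left_le {τ : ℝ} (hτ : 0 < τ) (x : ℕ → H) {t : ℝ} (ht : 0 ≤ t) :
    ‖plInterp τ x t - x ⌊t / τ⌋₊‖ ≤ ‖x (⌊t / τ⌋₊ + 1) - x ⌊t / τ⌋₊‖ := by
  have h1 := Nat.floor_le (div_nonneg ht hτ.le)
  have h2 := Nat.lt_floor_add_one (t / τ)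
  rw [plInterp, add_sub_cancel_left, norm_smul, Real.norm_of_nonneg (by linarith)]
  exact mul_le_of_le_one_left (norm_nonneg _) (by linarith)

lemma norm_plInterp_sub_right_le {τ : ℝ} (hτ : 0 < τ) (x : ℕ → H) {t : ℝ} (ht : 0 ≤ t) :
    ‖plInterp τ x t - x (⌊t / τ⌋₊ + 1)‖ ≤ ‖x (⌊t / τ⌋₊ + 1) - x ⌊t / τ⌋₊‖ := by
  have h1 := Nat.floor_le (div_nonneg ht hτ.le)
  have h2 := Nat.lt_floor_add_one (t / τ)
  have h3 : plInterp τ x t - x (⌊t / τ⌋₊ + 1)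
      = -((1 - (t / τ - ⌊t / τ⌋₊)) • (x (⌊t / τ⌋₊ + 1) - x ⌊t / τ⌋₊)) := by
    rw [plInterp]; module
  rw [h3, norm_neg, norm_smul, Real.norm_of_nonneg (by linarith)]
  exact mul_le_of_le_one_left (norm_nonneg _) (by linarith)

end Interpolation

/-! ### A priori bounds for the trapezoidal rule -/

section CrankNicolson

variable {H : Type*} [NormedAddCommGroup H] [InnerProductSpace ℝ H]

/-- The trapezoidal (Crank–Nicolson) recursion with step `τ` for the equation `X' = -A X`. It is
implicit, so it is stated as a property of a sequence. -/
def IsCrankNicolson (A : H → H) (τ : ℝ) (x : ℕ → H) : Prop :=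
  ∀ n, x (n + 1) = x n - (τ / 2) • (A (x n) + A (x (n + 1)))

variable {A : H → H} {L : ℝ}

/-- Along the recursion the norm of the field grows at most exponentially: the sum of two
consecutive values is parallel to the increment, so testing semi-monotonicity with the increment
compares the two norms. -/
lemma norm_sq_apply_le_of_isCrankNicolson (hL : 0 ≤ L)
    (hA : ∀ x y, -L * ‖y - x‖ ^ 2 ≤ inner ℝ (A y - A x) (y - x)) {τ : ℝ} (hτ : 0 < τ)
    (hτL : L * τ ≤ 1 / 2) {x : ℕ → H} (hx : IsCrankNicolson A τ x) (n : ℕ) :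
    ‖A (x n)‖ ^ 2 ≤ Real.exp (4 * L * (n * τ)) * ‖A (x 0)‖ ^ 2 := by
  induction n with
  | zero => simp
  | succ n ih =>
    set a := A (x n) with ha
    set b := A (x (n + 1)) with hb
    have h1 := hA (x n) (x (n + 1))
    have h2 : x (n + 1) - x n = -((τ / 2) • (a + b)) := by
      rw [sub_eq_iff_eq_add', ← sub_eq_add_neg]
      exact hx n
    rw [h2, norm_neg, norm_smul, Real.norm_of_nonneg (by positivity), inner_neg_right,
      inner_smul_right, ← ha, ← hb] at h1
    have h3 : inner ℝ (b - a) (a + b) = ‖b‖ ^ 2 - ‖a‖ ^ 2 := by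
      rw [inner_sub_left, inner_add_right, inner_add_right, real_inner_self_eq_norm_sq,
        real_inner_self_eq_norm_sq, real_inner_comm a b]
      ring
    rw [h3] at h1
    have h4 : ‖a + b‖ ^ 2 ≤ 2 * (‖a‖ ^ 2 + ‖b‖ ^ 2) := by
      have := parallelogram_law_with_norm ℝ a b
      nlinarith [sq_nonneg ‖a - b‖]
    have h5 : ‖b‖ ^ 2 - ‖a‖ ^ 2 ≤ L * τ * (‖a‖ ^ 2 + ‖b‖ ^ 2) := by
      have h6 : τ / 2 * (‖b‖ ^ 2 - ‖a‖ ^ 2) ≤ τ / 2 * (L * τ * (‖a‖ ^ 2 + ‖b‖ ^ 2)) := by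
        have : L * (τ / 2) ^ 2 * ‖a + b‖ ^ 2
            ≤ L * (τ / 2) ^ 2 * (2 * (‖a‖ ^ 2 + ‖b‖ ^ 2)) := by gcongr
        nlinarith
      exact le_of_mul_le_mul_left h6 (by positivity)
    have h6 : 0 ≤ L * τ := by positivity
    have h7 : ‖b‖ ^ 2 ≤ (1 + 4 * (L * τ)) * ‖a‖ ^ 2 := by
      nlinarith [sq_nonneg ‖a‖, sq_nonneg ‖b‖, mul_nonneg h6 (sq_nonneg ‖a‖),
        mul_nonneg (mul_nonneg h6 (sub_nonneg.2 hτL)) (sq_nonneg ‖a‖)]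
    calc ‖b‖ ^ 2 ≤ (1 + 4 * (L * τ)) * ‖a‖ ^ 2 := h7
      _ ≤ Real.exp (4 * (L * τ)) * (Real.exp (4 * L * (n * τ)) * ‖A (x 0)‖ ^ 2) := by
        gcongr
        linarith [Real.add_one_le_exp (4 * (L * τ))]
      _ = _ := by
        rw [← mul_assoc, ← Real.exp_add]
        push_cast
        ring_nf

lemma norm_apply_le_of_isCrankNicolson (hL : 0 ≤ L)
    (hA : ∀ x y, -L * ‖y - x‖ ^ 2 ≤ inner ℝ (A y - A x) (y - x)) {τ : ℝ} (hτ : 0 < τ)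
    (hτL : L * τ ≤ 1 / 2) {x : ℕ → H} (hx : IsCrankNicolson A τ x) {C : ℝ}
    (hC : ‖A (x 0)‖ ≤ C) {T : ℝ} {n : ℕ} (hn : n * τ ≤ T) :
    ‖A (x n)‖ ≤ Real.exp (2 * L * T) * C := by
  have hC0 : 0 ≤ C := (norm_nonneg _).trans hC
  refine abs_le_of_sq_le_sq' ?_ (by positivity) |>.2
  calc ‖A (x n)‖ ^ 2 ≤ Real.exp (4 * L * (n * τ)) * ‖A (x 0)‖ ^ 2 :=
        norm_sq_apply_le_of_isCrankNicolson hL hA hτ hτL hx n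
    _ ≤ Real.exp (4 * L * T) * C ^ 2 := by gcongr
    _ = _ := by
      rw [mul_pow, ← Real.exp_nat_mul]
      push_cast
      ring_nf

lemma IsCrankNicolson.sub_eq {τ : ℝ} {x : ℕ → H} (hx : IsCrankNicolson A τ x) (n : ℕ) :
    x (n + 1) - x n = -((τ / 2) • (A (x n) + A (x (n + 1)))) := by
  rw [sub_eq_iff_eq_add', ← sub_eq_add_neg]
  exact hx n

lemma IsCrankNicolson.norm_sub_le {τ : ℝ} (hτ : 0 < τ) {x : ℕ → H}
    (hx : IsCrankNicolson A τ x) {M : ℝ} {n : ℕ} (h1 : ‖A (x n)‖ ≤ M)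
    (h2 : ‖A (x (n + 1))‖ ≤ M) : ‖x (n + 1) - x n‖ ≤ M * τ := by
  rw [hx.sub_eq, norm_neg, norm_smul, Real.norm_of_nonneg (by positivity)]
  have := norm_add_le (A (x n)) (A (x (n + 1)))
  nlinarith

lemma IsCrankNicolson.inv_smul_sub_eq {τ : ℝ} (hτ : 0 < τ) {x : ℕ → H}
    (hx : IsCrankNicolson A τ x) (n : ℕ) :
    τ⁻¹ • (x (n + 1) - x n) = -((1 / 2 : ℝ) • (A (x n) + A (x (n + 1)))) := by
  rw [hx.sub_eq, smul_neg, smul_smul]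
  congr 2
  field_simp

/-- Perturbed semi-monotonicity: `D` is a vector which differs from `x - y` by at most `e`. -/
lemma neg_inner_sub_le (hL : 0 ≤ L)
    (hA : ∀ x y, -L * ‖y - x‖ ^ 2 ≤ inner ℝ (A y - A x) (y - x)) {x y D : H} {M e : ℝ}
    (hx : ‖A x‖ ≤ M) (hy : ‖A y‖ ≤ M) (hD : ‖D - (x - y)‖ ≤ e) :
    -inner ℝ D (A x - A y) ≤ 2 * L * ‖D‖ ^ 2 + 2 * L * e ^ 2 + 2 * M * e := by
  have h1 := hA y x
  have he : 0 ≤ e := (norm_nonneg _).trans hD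
  have h2 : inner ℝ D (A x - A y)
      = inner ℝ (A x - A y) (x - y) + inner ℝ (D - (x - y)) (A x - A y) := by
    rw [real_inner_comm (x - y) (A x - A y), ← inner_add_left]
    simp
  have h3 : |inner ℝ (D - (x - y)) (A x - A y)| ≤ e * (2 * M) := by
    refine (abs_real_inner_le_norm _ _).trans ?_
    gcongr
    exact (norm_sub_le _ _).trans (by linarith)
  have h4 : ‖x - y‖ ^ 2 ≤ 2 * ‖D‖ ^ 2 + 2 * e ^ 2 := by
    have h5 : ‖x - y‖ ≤ ‖D‖ + e := by
      have := norm_sub_le D (D - (x - y))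
      rw [sub_sub_cancel] at this
      linarith
    nlinarith [norm_nonneg (x - y), sq_nonneg (‖D‖ - e)]
  have h5 := (abs_le.1 h3).1
  nlinarith

end CrankNicolson

/-! ### Convergence of the trapezoidal rule -/

section Convergence

variable {H : Type*} [NormedAddCommGroup H] [InnerProductSpace ℝ H]
variable {A : H → H} {L : ℝ}

/-- Stability of the piecewise affine interpolations with respect to the step and the initial
value: a Gronwall estimate for the squared distance, whose derivative is controlled by
semi-monotonicity at the four pairs of neighbouring nodes. -/
lemma norm_sq_plInterp_sub_le (hL : 0 ≤ L)
    (hA : ∀ x y, -L * ‖y - x‖ ^ 2 ≤ inner ℝ (A y - A x) (y - x)) {τ σ : ℝ} (hτ : 0 < τ)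
    (hσ : 0 < σ) {x y : ℕ → H} (hx : IsCrankNicolson A τ x) (hy : IsCrankNicolson A σ y)
    {T M : ℝ}
    (hxM : ∀ t ∈ Icc 0 T, ‖A (x ⌊t / τ⌋₊)‖ ≤ M ∧ ‖A (x (⌊t / τ⌋₊ + 1))‖ ≤ M)
    (hyM : ∀ t ∈ Icc 0 T, ‖A (y ⌊t / σ⌋₊)‖ ≤ M ∧ ‖A (y (⌊t / σ⌋₊ + 1))‖ ≤ M)
    {t : ℝ} (ht : t ∈ Icc 0 T) :
    ‖plInterp τ x t - plInterp σ y t‖ ^ 2 ≤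
      (‖x 0 - y 0‖ ^ 2 + (4 * L * (M * τ + M * σ) ^ 2 + 4 * M * (M * τ + M * σ)))
        * Real.exp ((4 * L + 1) * T) := by
  set D : ℝ → H := fun t => plInterp τ x t - plInterp σ y t with hDdef
  set e := M * τ + M * σ with he
  set ε := 4 * L * e ^ 2 + 4 * M * e with hε
  have hM : 0 ≤ M := (norm_nonneg _).trans (hxM t ht).1
  have he0 : 0 ≤ e := by positivity
  have hε0 : 0 ≤ ε := by positivity
  set D' : ℝ → H := fun t => τ⁻¹ • (x (⌊t / τ⌋₊ + 1) - x ⌊t / τ⌋₊)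
    - σ⁻¹ • (y (⌊t / σ⌋₊ + 1) - y ⌊t / σ⌋₊) with hD'
  have hD : ∀ s, 0 ≤ s → HasDerivWithinAt D (D' s) (Ici s) s := fun s hs =>
    (hasDerivWithinAt_plInterp hτ x hs).sub (hasDerivWithinAt_plInterp hσ y hs)
  have hG := le_gronwallBound_of_liminf_deriv_right_le (f := fun s => ‖D s‖ ^ 2)
    (f' := fun s => 2 * inner ℝ (D s) (D' s)) (δ := ‖x 0 - y 0‖ ^ 2) (K := 4 * L + 1) (ε := ε)
    (a := 0) (b := T)
    ((((continuousOn_plInterp hτ x T).sub (continuousOn_plInterp hσ y T)).norm).pow 2)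
    (fun s hs r hr => ((hD s hs.1).norm_sq).liminf_right_slope_le hr)
    (by simp [hDdef, plInterp_zero])
    (fun s hs => by
      have hs' := Ico_subset_Icc_self hs
      obtain ⟨ha, ha'⟩ := hxM s hs'
      obtain ⟨hb, hb'⟩ := hyM s hs'
      have hP1 := (norm_plInterp_sub_left_le hτ x hs.1).trans (hx.norm_sub_le hτ ha ha')
      have hP2 := (norm_plInterp_sub_right_le hτ x hs.1).trans (hx.norm_sub_le hτ ha ha')
      have hQ1 := (norm_plInterp_sub_left_le hσ y hs.1).trans (hy.norm_sub_le hσ hb hb')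
      have hQ2 := (norm_plInterp_sub_right_le hσ y hs.1).trans (hy.norm_sub_le hσ hb hb')
      have hdist : ∀ u v : H, ‖plInterp τ x s - u‖ ≤ M * τ → ‖plInterp σ y s - v‖ ≤ M * σ →
          ‖D s - (u - v)‖ ≤ e := by
        intro u v hu hv
        have h1 : D s - (u - v) = (plInterp τ x s - u) - (plInterp σ y s - v) := by
          simp only [hDdef]; abel
        rw [h1]
        exact (norm_sub_le _ _).trans (add_le_add hu hv)
      have h11 := neg_inner_sub_le hL hA ha hb (hdist _ _ hP1 hQ1)
      have h12 := neg_inner_sub_le hL hA ha hb' (hdist _ _ hP1 hQ2)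
      have h21 := neg_inner_sub_le hL hA ha' hb (hdist _ _ hP2 hQ1)
      have h22 := neg_inner_sub_le hL hA ha' hb' (hdist _ _ hP2 hQ2)
      have h2 : inner ℝ (D s) (D' s) =
          (1 / 4) * (-inner ℝ (D s) (A (x ⌊s / τ⌋₊) - A (y ⌊s / σ⌋₊))
            + -inner ℝ (D s) (A (x ⌊s / τ⌋₊) - A (y (⌊s / σ⌋₊ + 1)))
            + -inner ℝ (D s) (A (x (⌊s / τ⌋₊ + 1)) - A (y ⌊s / σ⌋₊))
            + -inner ℝ (D s) (A (x (⌊s / τ⌋₊ + 1)) - A (y (⌊s / σ⌋₊ + 1)))) := by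
        simp only [hD', hx.inv_smul_sub_eq hτ, hy.inv_smul_sub_eq hσ, inner_sub_right,
          inner_neg_right, inner_smul_right, inner_add_right]
        ring
      rw [h2]
      nlinarith [sq_nonneg ‖D s‖]) t ht
  refine hG.trans ?_
  rw [gronwallBound_of_K_ne_0 (by positivity), sub_zero]
  have h1 : Real.exp ((4 * L + 1) * t) ≤ Real.exp ((4 * L + 1) * T) := by
    gcongr; exact ht.2
  have h2 : ε / (4 * L + 1) ≤ ε := div_le_self hε0 (by linarith)
  have h3 : 1 ≤ Real.exp ((4 * L + 1) * t) := Real.one_le_exp (mul_nonneg (by positivity) ht.1)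
  calc ‖x 0 - y 0‖ ^ 2 * Real.exp ((4 * L + 1) * t)
        + ε / (4 * L + 1) * (Real.exp ((4 * L + 1) * t) - 1)
      ≤ ‖x 0 - y 0‖ ^ 2 * Real.exp ((4 * L + 1) * T)
        + ε * Real.exp ((4 * L + 1) * T) := by
        gcongr
        linarith
    _ = _ := by ring

/-- Convergence of the trapezoidal recursion: for a continuous semi-monotone field and bounded
initial velocities, the piecewise constant interpolations converge, locally uniformly in time, to a
locally Lipschitz solution of `X' = -A X`. -/
theorem exists_flow_of_isCrankNicolson [CompleteSpace H] (hL : 0 ≤ L)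
    (hA : ∀ x y, -L * ‖y - x‖ ^ 2 ≤ inner ℝ (A y - A x) (y - x)) (hAc : Continuous A)
    {x₀ : H} {x : ℝ → ℕ → H} {C : ℝ}
    (hx : ∀ᶠ τ in 𝓝[>] (0 : ℝ), IsCrankNicolson A τ (x τ))
    (hx0 : Tendsto (fun τ => x τ 0) (𝓝[>] 0) (𝓝 x₀))
    (hC : ∀ᶠ τ in 𝓝[>] (0 : ℝ), ‖A (x τ 0)‖ ≤ C) :
    ∃ X : ℝ → H, X 0 = x₀ ∧
      (∀ T : ℝ, TendstoUniformlyOn (fun τ t => pcInterp τ (x τ) t) X (𝓝[>] 0) (Icc 0 T)) ∧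
      (∀ T : ℝ, ∃ K, LipschitzOnWith K X (Icc 0 T)) ∧
      ∀ t, 0 < t → HasDerivAt X (-A (X t)) t := by
  -- One bound on the field covers the two nodes around any time in `[0, T]`.
  have hbound : ∀ T : ℝ, ∃ M : ℝ, ∀ᶠ τ in 𝓝[>] (0 : ℝ), (0 < τ ∧ IsCrankNicolson A τ (x τ)) ∧
      ∀ t ∈ Icc 0 T, ‖A (x τ ⌊t / τ⌋₊)‖ ≤ M ∧ ‖A (x τ (⌊t / τ⌋₊ + 1))‖ ≤ M := by
    intro T
    refine ⟨Real.exp (2 * L * (T + 1)) * C, ?_⟩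
    have hsmall : ∀ᶠ τ in 𝓝[>] (0 : ℝ), L * τ < 1 / 2 := by
      have : Tendsto (fun τ : ℝ => L * τ) (𝓝[>] 0) (𝓝 (L * 0)) :=
        Tendsto.mono_left (Continuous.tendsto (by fun_prop) 0) nhdsWithin_le_nhds
      exact this.eventually_lt_const (by norm_num)
    filter_upwards [hx, hC, hsmall, Ioo_mem_nhdsGT (zero_lt_one' ℝ)] with τ h1 h2 h3 h4
    refine ⟨⟨h4.1, h1⟩, fun t ht => ?_⟩
    have hm := floor_mul_mem h4.1 ht.1
    constructor
    · exact norm_apply_le_of_isCrankNicolson hL hA h4.1 h3.le h1 h2 (by linarith [hm.1, ht.2])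
    · refine norm_apply_le_of_isCrankNicolson hL hA h4.1 h3.le h1 h2 ?_
      push_cast
      linarith [hm.1, ht.2, h4.2]
  choose M hM using hbound
  have htau : Tendsto (fun τ : ℝ => τ) (𝓝[>] 0) (𝓝 0) := tendsto_id.mono_left nhdsWithin_le_nhds
  have hnear : ∀ T : ℝ, ∀ᶠ τ in 𝓝[>] (0 : ℝ), ∀ t ∈ Icc 0 T,
      ‖plInterp τ (x τ) t - pcInterp τ (x τ) t‖ ≤ M T * τ := by
    intro T
    filter_upwards [hM T] with τ ⟨⟨h1, h2⟩, h3⟩ t ht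
    exact (norm_plInterp_sub_left_le h1 _ ht.1).trans
      (h2.norm_sub_le h1 (h3 t ht).1 (h3 t ht).2)
  have hcauchy : ∀ T : ℝ, UniformCauchySeqOn (fun τ t => pcInterp τ (x τ) t) (𝓝[>] 0)
      (Icc 0 T) := by
    intro T
    set B : ℝ × ℝ → ℝ := fun p => √((‖x p.1 0 - x p.2 0‖ ^ 2
      + (4 * L * (M T * p.1 + M T * p.2) ^ 2 + 4 * M T * (M T * p.1 + M T * p.2)))
        * Real.exp ((4 * L + 1) * T)) + (M T * p.1 + M T * p.2) with hB
    have hBlim : Tendsto B (𝓝[>] 0 ×ˢ 𝓝[>] 0) (𝓝 0) := by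
      have hp1 : Tendsto (fun p : ℝ × ℝ => p.1) (𝓝[>] (0 : ℝ) ×ˢ 𝓝[>] (0 : ℝ)) (𝓝 0) :=
        htau.comp tendsto_fst
      have hp2 : Tendsto (fun p : ℝ × ℝ => p.2) (𝓝[>] (0 : ℝ) ×ˢ 𝓝[>] (0 : ℝ)) (𝓝 0) :=
        htau.comp tendsto_snd
      have hx1 : Tendsto (fun p : ℝ × ℝ => x p.1 0) (𝓝[>] (0 : ℝ) ×ˢ 𝓝[>] (0 : ℝ)) (𝓝 x₀) :=
        hx0.comp tendsto_fst
      have hx2 : Tendsto (fun p : ℝ × ℝ => x p.2 0) (𝓝[>] (0 : ℝ) ×ˢ 𝓝[>] (0 : ℝ)) (𝓝 x₀) :=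
        hx0.comp tendsto_snd
      have he : Tendsto (fun p : ℝ × ℝ => M T * p.1 + M T * p.2)
          (𝓝[>] (0 : ℝ) ×ˢ 𝓝[>] (0 : ℝ)) (𝓝 (M T * 0 + M T * 0)) :=
        (hp1.const_mul _).add (hp2.const_mul _)
      have := ((((((hx1.sub hx2).norm).pow 2).add (((he.pow 2).const_mul (4 * L)).add
        (he.const_mul (4 * M T)))).mul_const (Real.exp ((4 * L + 1) * T))).sqrt).add he
      simpa using this
    intro U hU
    obtain ⟨ε, hε, hU⟩ := Metric.mem_uniformity_dist.1 hU
    filter_upwards [hBlim.eventually_lt_const hε, (hM T).prod_mk (hM T),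
      (hnear T).prod_mk (hnear T)] with ⟨τ, σ⟩ hBε ⟨⟨⟨h1, h2⟩, h3⟩, ⟨⟨k1, k2⟩, k3⟩⟩ ⟨n1, n2⟩ t ht
    refine hU (lt_of_le_of_lt ?_ hBε)
    have h4 := norm_sq_plInterp_sub_le hL hA h1 k1 h2 k2 h3 k3 ht
    have h5 := Real.le_sqrt_of_sq_le h4
    have n1' := n1 t ht
    have n2' := n2 t ht
    rw [norm_sub_rev] at n1'
    rw [dist_eq_norm]
    have h6 : pcInterp τ (x τ) t - pcInterp σ (x σ) t
        = (pcInterp τ (x τ) t - plInterp τ (x τ) t) + (plInterp τ (x τ) t - plInterp σ (x σ) t)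
          + (plInterp σ (x σ) t - pcInterp σ (x σ) t) := by abel
    rw [h6]
    refine (norm_add₃_le).trans ?_
    simp only [hB]
    linarith
  have hlim : ∀ t : ℝ, ∃ y : H, 0 ≤ t →
      Tendsto (fun τ => pcInterp τ (x τ) t) (𝓝[>] 0) (𝓝 y) := by
    intro t
    by_cases ht : 0 ≤ t
    · obtain ⟨y, hy⟩ := cauchy_map_iff_exists_tendsto.1
        ((hcauchy t).cauchy_map (x := t) ⟨ht, le_rfl⟩)
      exact ⟨y, fun _ => hy⟩
    · exact ⟨0, fun h => absurd h ht⟩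
  choose X hX using hlim
  have hunif : ∀ T : ℝ, TendstoUniformlyOn (fun τ t => pcInterp τ (x τ) t) X (𝓝[>] 0)
      (Icc 0 T) := fun T =>
    (hcauchy T).tendstoUniformlyOn_of_tendsto (fun t ht => hX t ht.1)
  have hXpl : ∀ t : ℝ, 0 ≤ t → Tendsto (fun τ => plInterp τ (x τ) t) (𝓝[>] 0) (𝓝 (X t)) := by
    intro t ht
    have h1 : Tendsto (fun τ => plInterp τ (x τ) t - pcInterp τ (x τ) t) (𝓝[>] 0) (𝓝 0) := by
      refine squeeze_zero_norm' ((hnear t).mono fun τ h => h t ⟨ht, le_rfl⟩) ?_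
      simpa using htau.const_mul (M t)
    simpa using h1.add (hX t ht)
  have hLip : ∀ T a b : ℝ, 0 ≤ a → a ≤ b → b ≤ T → ‖X b - X a‖ ≤ M T * (b - a) := by
    intro T a b ha hab hb
    refine le_of_tendsto ((hXpl b (ha.trans hab)).sub (hXpl a ha)).norm ?_
    filter_upwards [hM T] with τ ⟨⟨h1, h2⟩, h3⟩
    refine norm_image_sub_le_of_norm_deriv_right_le_segment
      ((continuousOn_plInterp h1 (x τ) T).mono (Icc_subset_Icc ha hb))
      (fun s hs => hasDerivWithinAt_plInterp h1 (x τ) (ha.trans hs.1))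
      (fun s hs => ?_) b ⟨hab, le_rfl⟩
    obtain ⟨h4, h5⟩ := h3 s ⟨ha.trans hs.1, hs.2.le.trans hb⟩
    rw [norm_smul, norm_inv, Real.norm_of_nonneg h1.le, inv_mul_le_iff₀ h1, mul_comm τ]
    exact h2.norm_sub_le h1 h4 h5
  have hLip' : ∀ T a b : ℝ, a ∈ Icc 0 T → b ∈ Icc 0 T → ‖X b - X a‖ ≤ |M T| * |b - a| := by
    intro T a b ha hb
    rcases le_total a b with h | h
    · refine (hLip T a b ha.1 h hb.2).trans ?_
      rw [abs_of_nonneg (sub_nonneg.2 h)]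
      exact mul_le_mul_of_nonneg_right (le_abs_self _) (sub_nonneg.2 h)
    · rw [norm_sub_rev, abs_sub_comm]
      refine (hLip T b a hb.1 h ha.2).trans ?_
      rw [abs_of_nonneg (sub_nonneg.2 h)]
      exact mul_le_mul_of_nonneg_right (le_abs_self _) (sub_nonneg.2 h)
  refine ⟨X, ?_, hunif, fun T => ⟨|M T|.toNNReal, ?_⟩, fun t ht => ?_⟩
  · refine tendsto_nhds_unique (hXpl 0 le_rfl) ?_
    simpa only [plInterp_zero] using hx0
  · refine LipschitzOnWith.of_dist_le_mul fun a ha b hb => ?_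
    rw [Real.coe_toNNReal _ (abs_nonneg _), dist_eq_norm, dist_eq_norm, Real.norm_eq_abs]
    exact hLip' T b a hb ha
  · rw [hasDerivAt_iff_isLittleO, Asymptotics.isLittleO_iff]
    intro ε hε
    obtain ⟨δ, hδ, hAδ⟩ := Metric.continuousAt_iff.1 (hAc.continuousAt (x := X t)) ε hε
    obtain ⟨r, hr, hr1, hrt, hrδ⟩ : ∃ r : ℝ, 0 < r ∧ r ≤ 1 ∧ r ≤ t ∧ |M (t + 1)| * r ≤ δ / 4 := by
      refine ⟨min (min 1 t) (δ / 4 / (|M (t + 1)| + 1)), by positivity,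
        (min_le_left _ _).trans (min_le_left _ _), (min_le_left _ _).trans (min_le_right _ _), ?_⟩
      calc |M (t + 1)| * min (min 1 t) (δ / 4 / (|M (t + 1)| + 1))
          ≤ (|M (t + 1)| + 1) * (δ / 4 / (|M (t + 1)| + 1)) := by
            gcongr
            · linarith
            · exact min_le_right _ _
        _ = δ / 4 := by field_simp
    -- Near `t` all nodal values are close to `X t`, so the right derivative of the interpolation
    -- stays `ε`-close to `-A (X t)`.
    have key : ∀ a b : ℝ, t - r ≤ a → a ≤ b → b ≤ t + r →
        ‖X b - X a + (b - a) • A (X t)‖ ≤ ε * (b - a) := by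
      intro a b ha hab hb
      have ha0 : 0 ≤ a := by linarith
      have hlim2 : Tendsto (fun τ => plInterp τ (x τ) b - plInterp τ (x τ) a + (b - a) • A (X t))
          (𝓝[>] 0) (𝓝 (X b - X a + (b - a) • A (X t))) :=
        ((hXpl b (ha0.trans hab)).sub (hXpl a ha0)).add_const _
      refine le_of_tendsto hlim2.norm ?_
      have hMτ : ∀ᶠ τ in 𝓝[>] (0 : ℝ), M (t + 1) * τ < δ / 4 := by
        have : Tendsto (fun τ : ℝ => M (t + 1) * τ) (𝓝[>] 0) (𝓝 (M (t + 1) * 0)) :=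
          htau.const_mul _
        exact this.eventually_lt_const (by rw [mul_zero]; positivity)
      filter_upwards [hM (t + 1), hMτ,
        Metric.tendstoUniformlyOn_iff.1 (hunif (t + 1)) (δ / 4) (by positivity)]
        with τ ⟨⟨h1, h2⟩, h3⟩ h4 h5
      have hseg := norm_image_sub_le_of_norm_deriv_right_le_segment
        (f := fun s => plInterp τ (x τ) s + s • A (X t)) (a := a) (b := b) (C := ε)
        (f' := fun s => τ⁻¹ • (x τ (⌊s / τ⌋₊ + 1) - x τ ⌊s / τ⌋₊) + (1 : ℝ) • A (X t))
        (ContinuousOn.add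
          ((continuousOn_plInterp h1 (x τ) (t + 1)).mono (Icc_subset_Icc ha0 (by linarith)))
          (by fun_prop))
        (fun s hs => (hasDerivWithinAt_plInterp h1 (x τ) (ha0.trans hs.1)).add
          (((hasDerivAt_id s).smul_const (A (X t))).hasDerivWithinAt))
        (fun s hs => by
          have hs' : s ∈ Icc 0 (t + 1) := ⟨ha0.trans hs.1, by linarith [hs.2]⟩
          obtain ⟨h6, h7⟩ := h3 s hs'
          have h8 : ‖X s - X t‖ ≤ δ / 4 := by
            refine (hLip' (t + 1) t s ⟨ht.le, by linarith⟩ hs').trans (le_trans ?_ hrδ)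
            gcongr
            rw [abs_le]
            constructor <;> linarith [hs.1, hs.2]
          have h9 := h5 s hs'
          rw [dist_comm, dist_eq_norm] at h9
          have h10 : ‖x τ ⌊s / τ⌋₊ - X t‖ < δ := by
            have : x τ ⌊s / τ⌋₊ - X t = (pcInterp τ (x τ) s - X s) + (X s - X t) := by
              simp [pcInterp]
            rw [this]
            exact (norm_add_le _ _).trans_lt (by linarith)
          have h11 : ‖x τ (⌊s / τ⌋₊ + 1) - X t‖ < δ := by
            have : x τ (⌊s / τ⌋₊ + 1) - X t = (x τ (⌊s / τ⌋₊ + 1) - x τ ⌊s / τ⌋₊)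
                + (pcInterp τ (x τ) s - X s) + (X s - X t) := by
              simp [pcInterp]
            rw [this]
            refine norm_add₃_le.trans_lt ?_
            have := h2.norm_sub_le h1 h6 h7
            linarith
          have h12 := hAδ (by rwa [dist_eq_norm] : dist (x τ ⌊s / τ⌋₊) (X t) < δ)
          have h13 := hAδ (by rwa [dist_eq_norm] : dist (x τ (⌊s / τ⌋₊ + 1)) (X t) < δ)
          rw [dist_eq_norm] at h12 h13
          have h14 : τ⁻¹ • (x τ (⌊s / τ⌋₊ + 1) - x τ ⌊s / τ⌋₊) + (1 : ℝ) • A (X t)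
              = -((1 / 2 : ℝ) • ((A (x τ ⌊s / τ⌋₊) - A (X t))
                + (A (x τ (⌊s / τ⌋₊ + 1)) - A (X t)))) := by
            rw [h2.inv_smul_sub_eq h1]; module
          rw [h14, norm_neg, norm_smul, Real.norm_of_nonneg (by norm_num)]
          have := norm_add_le (A (x τ ⌊s / τ⌋₊) - A (X t)) (A (x τ (⌊s / τ⌋₊ + 1)) - A (X t))
          linarith) b ⟨hab, le_rfl⟩
      have h6 : plInterp τ (x τ) b - plInterp τ (x τ) a + (b - a) • A (X t)
          = plInterp τ (x τ) b + b • A (X t) - (plInterp τ (x τ) a + a • A (X t)) := by module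
      rw [h6]
      exact hseg
    filter_upwards [Icc_mem_nhds (by linarith : t - r < t) (by linarith : t < t + r)] with s hs
    rcases le_total t s with h | h
    · have := key t s (by linarith) h hs.2
      rw [Real.norm_of_nonneg (sub_nonneg.2 h), smul_neg, sub_neg_eq_add]
      exact this
    · have := key s t hs.1 h (by linarith)
      have h1 : X s - X t - (s - t) • -A (X t) = -(X t - X s + (t - s) • A (X t)) := by module
      rw [Real.norm_of_nonpos (sub_nonpos.2 h), neg_sub, h1, norm_neg]
      exact this

end Convergence

/-! ### Transport of atomless measures -/

section Transport

lemma continuous_cdf_of_measure_singleton {μ : Measure ℝ} [IsProbabilityMeasure μ]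
    (hμ : ∀ x, μ {x} = 0) : Continuous (ProbabilityTheory.cdf μ) := by
  rw [continuous_iff_continuousAt]
  intro x
  have hmono := ProbabilityTheory.monotone_cdf μ
  rw [hmono.continuousAt_iff_leftLim_eq_rightLim, StieltjesFunction.rightLim_eq]
  have h1 := hμ x
  rw [← ProbabilityTheory.measure_cdf μ, StieltjesFunction.measure_singleton,
    ENNReal.ofReal_eq_zero] at h1
  exact le_antisymm (hmono.leftLim_le le_rfl) (by linarith)

/-- The probability integral transform: the distribution function of an atomless law maps it to the
uniform law. -/
lemma measure_cdf_le_of_measure_singleton {μ : Measure ℝ} [IsProbabilityMeasure μ]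
    (hμ : ∀ x, μ {x} = 0) {c : ℝ} (h0 : 0 ≤ c) (h1 : c ≤ 1) :
    μ {t | ProbabilityTheory.cdf μ t ≤ c} = ENNReal.ofReal c := by
  have hcont := continuous_cdf_of_measure_singleton hμ
  have hmono := ProbabilityTheory.monotone_cdf μ
  rcases eq_or_lt_of_le h1 with rfl | h1
  · have : {t | ProbabilityTheory.cdf μ t ≤ 1} = univ :=
      eq_univ_of_forall fun t => ProbabilityTheory.cdf_le_one μ t
    rw [this]; simp
  set S := {t | ProbabilityTheory.cdf μ t ≤ c} with hS
  have hub : ∃ b, c < ProbabilityTheory.cdf μ b :=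
    ((ProbabilityTheory.tendsto_cdf_atTop μ).eventually_const_lt h1).exists
  have hle : ∀ {a}, a ∈ S → ∃ d, ProbabilityTheory.cdf μ d = c := fun {a} ha =>
    mem_range_of_exists_le_of_exists_ge hcont ⟨a, ha⟩ (hub.imp fun _ h => h.le)
  rcases S.eq_empty_or_nonempty with hem | ⟨a, ha⟩
  · rw [hem, measure_empty]
    rcases eq_or_lt_of_le h0 with rfl | h0
    · simp
    · obtain ⟨a, ha⟩ := ((ProbabilityTheory.tendsto_cdf_atBot μ).eventually_lt_const h0).exists
      exact absurd (show a ∈ S from ha.le) (by simp [hem])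
  · obtain ⟨b, hb⟩ := hub
    have hbdd : BddAbove S := ⟨b, fun t ht => by
      by_contra! h
      exact absurd (hmono h.le) (not_le.2 (lt_of_le_of_lt ht hb))⟩
    have hclosed : IsClosed S := isClosed_le hcont continuous_const
    have hsup : sSup S ∈ S := hclosed.csSup_mem ⟨a, ha⟩ hbdd
    have hSeq : S = Iic (sSup S) := by
      ext t
      exact ⟨fun ht => le_csSup hbdd ht, fun ht => (hmono ht).trans hsup⟩
    obtain ⟨d, hd⟩ := hle ha
    have hval : ProbabilityTheory.cdf μ (sSup S) = c :=
      le_antisymm hsup (hd ▸ hmono (le_csSup hbdd (show d ∈ S from hd.le)))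
    rw [hSeq, ← ProbabilityTheory.ofReal_cdf, hval]

/-- An atomless probability measure on a standard Borel space can be transported to any probability
measure on a standard Borel space. -/
theorem exists_measurable_map_eq_of_measure_singleton {Ω E : Type*} [MeasurableSpace Ω]
    [StandardBorelSpace Ω] [MeasurableSpace E] [StandardBorelSpace E] [Nonempty E]
    {ρ : Measure Ω} [IsProbabilityMeasure ρ] (hρ : ∀ x, ρ {x} = 0) (ν : Measure E)
    [IsProbabilityMeasure ν] : ∃ f : Ω → E, Measurable f ∧ ρ.map f = ν := by
  obtain ⟨q, hq, hqν⟩ := ν.exists_measurable_map_eq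
  have he := measurableEmbedding_embeddingReal Ω
  set μ := ρ.map (embeddingReal Ω) with hμdef
  have : IsProbabilityMeasure μ := Measure.isProbabilityMeasure_map he.measurable.aemeasurable
  have hμ : ∀ x, μ {x} = 0 := by
    intro x
    rw [hμdef, he.map_apply]
    exact ((subsingleton_singleton (a := x)).preimage he.injective).induction_on
      (p := fun s => ρ s = 0) measure_empty hρ
  set G : ℝ → unitInterval := fun t => ⟨ProbabilityTheory.cdf μ t,
    ProbabilityTheory.cdf_nonneg μ t, ProbabilityTheory.cdf_le_one μ t⟩ with hG
  have hGm : Measurable G :=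
    (continuous_cdf_of_measure_singleton hμ).measurable.subtype_mk
  have hGmap : μ.map G = volume := by
    have := Measure.isProbabilityMeasure_map (μ := μ) hGm.aemeasurable
    refine Measure.ext_of_Iic _ _ fun c => ?_
    rw [Measure.map_apply hGm measurableSet_Iic, unitInterval.volume_Iic,
      ← measure_cdf_le_of_measure_singleton hμ c.2.1 c.2.2]
    rfl
  refine ⟨q ∘ G ∘ embeddingReal Ω, hq.comp (hGm.comp he.measurable), ?_⟩
  rw [← Measure.map_map hq (hGm.comp he.measurable), ← Measure.map_map hGm he.measurable,
    ← hμdef, hGmap, hqν]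

/-- Density of graphs: any coupling `Θ` of an atomless measure `ρ` with another measure is induced
by a map `η`, as far as the joint law of the second component and of a given simple function of the
first component is concerned. The map `η` is built separately on every fibre of `s`. -/
theorem exists_map_prodMk_simpleFunc_eq {Ω E S : Type*} [MeasurableSpace Ω]
    [StandardBorelSpace Ω] [MeasurableSpace E] [StandardBorelSpace E] [Nonempty E]
    [MeasurableSpace S] {ρ : Measure Ω} [IsProbabilityMeasure ρ] (hρ : ∀ x, ρ {x} = 0)
    {Θ : Measure (Ω × E)} (hΘ : Θ.fst = ρ) (s : SimpleFunc Ω S) :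
    ∃ η : Ω → E, Measurable η ∧
      ρ.map (fun ω => (s ω, η ω)) = Θ.map (fun p => (s p.1, p.2)) := by
  have hcell : ∀ i : S, ∃ T : Ω → E, Measurable T ∧ ∀ B : Set E, MeasurableSet B →
      ρ (s ⁻¹' {i} ∩ T ⁻¹' B) = Θ ((s ⁻¹' {i}) ×ˢ B) := by
    intro i
    set a := s ⁻¹' {i} with ha
    have ham : MeasurableSet a := s.measurableSet_fiber i
    have hmass : Θ (a ×ˢ univ) = ρ a := by
      rw [← hΘ, Measure.fst_apply ham, prod_univ]
    by_cases h0 : ρ a = 0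
    · refine ⟨fun _ => Classical.arbitrary E, measurable_const, fun B hB => ?_⟩
      rw [measure_mono_null inter_subset_left h0, eq_comm]
      exact measure_mono_null (prod_mono le_rfl (subset_univ B)) (hmass.trans h0)
    · have htop : ρ a ≠ ∞ := measure_ne_top _ _
      set ρ' := (ρ a)⁻¹ • ρ.restrict a with hρ'
      set ν' := (ρ a)⁻¹ • (Θ.restrict (a ×ˢ univ)).snd with hν'
      have : IsProbabilityMeasure ρ' := ⟨by
        simp [hρ', ENNReal.inv_mul_cancel h0 htop]⟩
      have : IsProbabilityMeasure ν' := ⟨by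
        rw [hν', Measure.smul_apply, Measure.snd_univ, Measure.restrict_apply_univ, hmass,
          smul_eq_mul, ENNReal.inv_mul_cancel h0 htop]⟩
      obtain ⟨T, hT, hTν⟩ := exists_measurable_map_eq_of_measure_singleton (ρ := ρ')
        (fun x => by
          have h0 : ρ.restrict a {x} = 0 :=
            le_antisymm ((Measure.restrict_apply_le _ _).trans (hρ x).le) zero_le
          rw [hρ', Measure.smul_apply, smul_eq_mul, h0, mul_zero]) ν'
      refine ⟨T, hT, fun B hB => ?_⟩
      have h1 := congr_arg (fun m : Measure E => m B) hTν
      simp only [Measure.map_apply hT hB, hρ', hν', Measure.smul_apply, smul_eq_mul,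
        Measure.restrict_apply (hT hB), Measure.snd_apply hB,
        Measure.restrict_apply (measurable_snd hB)] at h1
      have h2 := congr_arg (fun r => ρ a * r) h1
      simp only [← mul_assoc, ENNReal.mul_inv_cancel h0 htop, one_mul] at h2
      rw [inter_comm, h2]
      congr 1
      ext p
      simp [and_comm]
  choose T hT hTcell using hcell
  have hη : Measurable (fun ω => T (s ω) ω) := s.measurable_bind T hT
  refine ⟨fun ω => T (s ω) ω, hη, ?_⟩
  have hm1 : Measurable (fun ω => (s ω, T (s ω) ω)) := s.measurable.prodMk hη
  have hm2 : Measurable (fun p : Ω × E => (s p.1, p.2)) :=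
    (s.measurable.comp measurable_fst).prodMk measurable_snd
  ext C hC
  rw [Measure.map_apply hm1 hC, Measure.map_apply hm2 hC]
  have hfib : ∀ i, MeasurableSet ((fun p : Ω × E => s p.1) ⁻¹' {i}) := fun i =>
    measurable_fst (s.measurableSet_fiber i)
  have hsum1 := sum_measure_preimage_singleton (μ := ρ.restrict ((fun ω => (s ω, T (s ω) ω)) ⁻¹' C))
    s.range (f := s) (fun i _ => s.measurableSet_fiber i)
  have hsum2 := sum_measure_preimage_singleton
    (μ := Θ.restrict ((fun p : Ω × E => (s p.1, p.2)) ⁻¹' C))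
    s.range (f := fun p : Ω × E => s p.1) (fun i _ => hfib i)
  have hu1 : s ⁻¹' (s.range : Set S) = univ := by ext; simp
  have hu2 : (fun p : Ω × E => s p.1) ⁻¹' (s.range : Set S) = univ := by ext; simp
  rw [hu1, Measure.restrict_apply_univ] at hsum1
  rw [hu2, Measure.restrict_apply_univ] at hsum2
  rw [← hsum1, ← hsum2]
  refine Finset.sum_congr rfl fun i _ => ?_
  rw [Measure.restrict_apply (s.measurableSet_fiber i),
    Measure.restrict_apply (hfib i)]
  have hB : MeasurableSet (Prod.mk i ⁻¹' C) := measurable_prodMk_left hC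
  have h1 : s ⁻¹' {i} ∩ (fun ω => (s ω, T (s ω) ω)) ⁻¹' C
      = s ⁻¹' {i} ∩ T i ⁻¹' (Prod.mk i ⁻¹' C) := by
    ext ω
    simp only [mem_inter_iff, mem_preimage, mem_singleton_iff]
    refine and_congr_right fun h => ?_
    rw [h]
  have h2 : (fun p : Ω × E => s p.1) ⁻¹' {i} ∩ (fun p : Ω × E => (s p.1, p.2)) ⁻¹' C
      = (s ⁻¹' {i}) ×ˢ (Prod.mk i ⁻¹' C) := by
    ext p
    simp only [mem_inter_iff, mem_preimage, mem_singleton_iff, mem_prod]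
    refine and_congr_right fun h => ?_
    rw [h]
  rw [h1, h2, hTcell i _ hB]

end Transport

/-! ### Square integrable functions -/

section L2

variable {α E : Type*} [MeasurableSpace α] {μ : Measure α} [NormedAddCommGroup E]
  [InnerProductSpace ℝ E]

lemma inner_toLp {f g : α → E} (hf : MemLp f 2 μ) (hg : MemLp g 2 μ) :
    inner ℝ (hf.toLp f) (hg.toLp g) = ∫ a, inner ℝ (f a) (g a) ∂μ := by
  rw [L2.inner_def]
  refine integral_congr_ae ?_
  filter_upwards [hf.coeFn_toLp, hg.coeFn_toLp] with a h1 h2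
  rw [h1, h2]

lemma norm_toLp_eq_sqrt {f : α → E} (hf : MemLp f 2 μ) :
    ‖hf.toLp f‖ = √(∫ a, ‖f a‖ ^ 2 ∂μ) := by
  rw [norm_eq_sqrt_real_inner, inner_toLp]
  simp_rw [real_inner_self_eq_norm_sq]

lemma integrable_inner_of_memLp {f g : α → E} (hf : MemLp f 2 μ) (hg : MemLp g 2 μ) :
    Integrable (fun a => inner ℝ (f a) (g a)) μ := by
  refine (L2.integrable_inner (𝕜 := ℝ) (hf.toLp f) (hg.toLp g)).congr ?_
  filter_upwards [hf.coeFn_toLp, hg.coeFn_toLp] with a h1 h2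
  rw [h1, h2]

/-- Jensen's inequality: the barycentres of the conditional laws of a coupling with square
integrable second marginal are square integrable. -/
lemma memLp_integral_kernel {F : Type*} [NormedAddCommGroup F] [NormedSpace ℝ F]
    [MeasurableSpace F] [BorelSpace F] [SecondCountableTopology F]
    [SFinite μ] {κ : ProbabilityTheory.Kernel α F} [ProbabilityTheory.IsMarkovKernel κ]
    (h : MemLp (fun p : α × F => p.2) 2 (μ.compProd κ)) :
    MemLp (fun x => ∫ y, y ∂κ x) 2 μ := by
  refine ⟨?_, ?_⟩
  · exact ((measurable_snd : Measurable fun p : α × F => p.2).stronglyMeasurable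
      |>.integral_kernel_prod_right' (κ := κ)).aestronglyMeasurable
  · have h1 := h.2
    rw [eLpNorm_lt_top_iff_lintegral_rpow_enorm_lt_top two_ne_zero ENNReal.ofNat_ne_top] at h1 ⊢
    refine lt_of_le_of_lt ?_ h1
    rw [Measure.lintegral_compProd (by fun_prop)]
    refine lintegral_mono fun x => ?_
    have h2 : ‖∫ y, y ∂κ x‖ₑ ≤ eLpNorm (fun y : F => y) 2 (κ x) := by
      refine (enorm_integral_le_lintegral_enorm _).trans ?_
      rw [← eLpNorm_one_eq_lintegral_enorm]
      exact eLpNorm_le_eLpNorm_of_exponent_le one_le_two aestronglyMeasurable_id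
    rw [eLpNorm_eq_lintegral_rpow_enorm_toReal two_ne_zero ENNReal.ofNat_ne_top] at h2
    have h3 := ENNReal.rpow_le_rpow h2 (z := (2 : ℝ≥0∞).toReal) ENNReal.toReal_nonneg
    rwa [← ENNReal.rpow_mul, one_div, inv_mul_cancel₀ (by norm_num), ENNReal.rpow_one] at h3

end L2

/-! ### Realization of transport plans by maps -/

section Plans

variable {d : ℕ}

lemma measurePreserving_push (ρ₀ : P2 d) (ξ : HSpace ρ₀) :
    MeasurePreserving ξ ρ₀.meas (push ρ₀ ξ).meas :=
  ⟨(Lp.stronglyMeasurable ξ).measurable, rfl⟩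

/-- The adjoint of the composition with `ξ`: a field `g` is averaged over the fibres of `ξ`, which
gives a vector field on the target space. -/
noncomputable def fiberAverage (ρ₀ : P2 d) (ξ g : HSpace ρ₀) : HSpace (push ρ₀ ξ) :=
  ContinuousLinearMap.adjoint
    (Lp.compMeasurePreservingₗᵢ ℝ ξ (measurePreserving_push ρ₀ ξ)).toContinuousLinearMap g

lemma integral_inner_fiberAverage (ρ₀ : P2 d) (ξ g : HSpace ρ₀) {f : Euc d → Euc d}
    (hf : MemLp f 2 (push ρ₀ ξ).meas) :
    ∫ x, inner ℝ (fiberAverage ρ₀ ξ g x) (f x) ∂(push ρ₀ ξ).meas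
      = ∫ ω, inner ℝ (g ω) (f (ξ ω)) ∂ρ₀.meas := by
  have hf' := hf.comp_measurePreserving (measurePreserving_push ρ₀ ξ)
  have h1 : inner ℝ (fiberAverage ρ₀ ξ g) (hf.toLp f) = inner ℝ g (hf'.toLp (f ∘ ξ)) := by
    rw [fiberAverage, ContinuousLinearMap.adjoint_inner_left]
    rfl
  rw [L2.inner_def, L2.inner_def] at h1
  refine Eq.trans (integral_congr_ae ?_) (h1.trans (integral_congr_ae ?_))
  · filter_upwards [hf.coeFn_toLp] with x hx
    rw [hx]
  · filter_upwards [hf'.coeFn_toLp] with x hx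
    rw [hx, Function.comp_apply]

lemma measurePreserving_fst_of_mem_plans {μ ν : P2 d} {γ : Measure (Euc d × Euc d)}
    (hγ : γ ∈ Plans μ ν) : MeasurePreserving Prod.fst γ μ.meas := ⟨measurable_fst, hγ.1⟩

lemma measurePreserving_snd_of_mem_plans {μ ν : P2 d} {γ : Measure (Euc d × Euc d)}
    (hγ : γ ∈ Plans μ ν) : MeasurePreserving Prod.snd γ ν.meas := ⟨measurable_snd, hγ.2⟩

lemma isProbabilityMeasure_of_mem_plans {μ ν : P2 d} {γ : Measure (Euc d × Euc d)}
    (hγ : γ ∈ Plans μ ν) : IsProbabilityMeasure γ := ⟨by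
  rw [← Measure.fst_univ, hγ.1, measure_univ]⟩

lemma push_toLp (ρ₀ : P2 d) {f : Euc d → Euc d} (hf : MemLp f 2 ρ₀.meas) :
    (push ρ₀ (hf.toLp f)).meas = ρ₀.meas.map f :=
  Measure.map_congr hf.coeFn_toLp

lemma lp_eq_toLp {μ : P2 d} (ξ : HSpace μ) : (Lp.memLp ξ).toLp ξ = ξ := Lp.toLp_coeFn ξ _

/-- Realization of plans by maps: if `ρ₀` has no atoms, then a plan starting at the law of `ξ` is
induced, up to a small error, by the displacement from `ξ` to a map `η` whose law is exactly the
second marginal. The map `η` is chosen almost conditionally independent of `g` given `ξ`, so that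
pairing with `g` sees the average of `g` over the fibres of `ξ` only. -/
theorem exists_push_eq_of_mem_plans {ρ₀ : P2 d} (hρ : ∀ x, ρ₀.meas {x} = 0) (ξ g : HSpace ρ₀)
    {ν : P2 d} {γ : Measure (Euc d × Euc d)} (hγ : γ ∈ Plans (push ρ₀ ξ) ν) {ε : ℝ}
    (hε : 0 < ε) :
    ∃ η : HSpace ρ₀, push ρ₀ η = ν ∧ ‖η - ξ‖ ≤ planDist γ + ε ∧
      |inner ℝ g (η - ξ) - ∫ p, inner ℝ (fiberAverage ρ₀ ξ g p.1) (p.2 - p.1) ∂γ| ≤ ε := by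
  have := isProbabilityMeasure_of_mem_plans hγ
  set μ := push ρ₀ ξ with hμ
  have hξm : Measurable ξ := (Lp.stronglyMeasurable ξ).measurable
  set κ := γ.condKernel with hκ
  have hγκ : μ.meas.compProd κ = γ := by rw [← hγ.1]; exact γ.disintegrate κ
  -- `Θ` glues `ρ₀` to `γ` along `ξ`, independently given `ξ`.
  set Θ := ρ₀.meas.compProd (κ.comap ξ hξm) with hΘ
  have hΘfst : Θ.fst = ρ₀.meas := Measure.fst_compProd _ _
  have hΘγ : MeasurePreserving (fun p : Euc d × Euc d => (ξ p.1, p.2)) Θ γ := by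
    refine ⟨by fun_prop, ?_⟩
    rw [← hγκ]
    ext B hB
    rw [Measure.map_apply (by fun_prop) hB, Measure.compProd_apply hB,
      Measure.compProd_apply ((by fun_prop : Measurable
        (fun p : Euc d × Euc d => (ξ p.1, p.2))) hB),
      ← (measurePreserving_push ρ₀ ξ).lintegral_comp
        (ProbabilityTheory.Kernel.measurable_kernel_prodMk_left hB)]
    rfl
  have hfst : MeasurePreserving Prod.fst Θ ρ₀.meas := ⟨measurable_fst, hΘfst⟩
  have hsnd : MeasurePreserving Prod.snd Θ ν.meas :=
    (measurePreserving_snd_of_mem_plans hγ).comp (f := fun p : Euc d × Euc d => (ξ p.1, p.2)) hΘγ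
  have hYm : MemLp (fun p : Euc d × Euc d => p.2) 2 Θ := ν.memLp.comp_measurePreserving hsnd
  have hξ2 := Lp.memLp ξ
  have hg2 := Lp.memLp g
  have hβ : MemLp (fun x => ∫ y, y ∂κ x) 2 μ.meas := by
    refine memLp_integral_kernel ?_
    rw [hγκ]
    exact ν.memLp.comp_measurePreserving (measurePreserving_snd_of_mem_plans hγ)
  have hζ := Lp.memLp (fiberAverage ρ₀ ξ g)
  have hζγ : MemLp (fun p : Euc d × Euc d => fiberAverage ρ₀ ξ g p.1) 2 γ :=
    hζ.comp_measurePreserving (measurePreserving_fst_of_mem_plans hγ)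
  have hγ1 : MemLp (fun p : Euc d × Euc d => p.1) 2 γ :=
    μ.memLp.comp_measurePreserving (measurePreserving_fst_of_mem_plans hγ)
  have hγ2 : MemLp (fun p : Euc d × Euc d => p.2) 2 γ :=
    ν.memLp.comp_measurePreserving (measurePreserving_snd_of_mem_plans hγ)
  have hgΘ : MemLp (fun p : Euc d × Euc d => g p.1) 2 Θ := hg2.comp_measurePreserving hfst
  have hξΘ : MemLp (fun p : Euc d × Euc d => ξ p.1) 2 Θ := hξ2.comp_measurePreserving hfst
  -- Given `ξ`, the second component is independent of `g` under `Θ`: both sides are pairings with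
  -- the conditional barycentre of `γ`.
  have hpair : ∫ p, inner ℝ (g p.1) p.2 ∂Θ
      = ∫ p, inner ℝ (fiberAverage ρ₀ ξ g p.1) p.2 ∂γ := by
    have h1 := integrable_inner_of_memLp hgΘ hYm
    have h2 := integrable_inner_of_memLp hζγ hγ2
    have hyint : ∀ᵐ x ∂μ.meas, Integrable (fun y : Euc d => y) (κ x) := by
      have h3 := hγ2.integrable one_le_two
      rw [← hγκ] at h3
      exact ((Measure.integrable_compProd_iff h3.1).1 h3).1
    have hyint' := (measurePreserving_push ρ₀ ξ).quasiMeasurePreserving.ae hyint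
    rw [Measure.integral_compProd h1]
    conv_rhs => rw [← hγκ]
    rw [← hγκ] at h2
    rw [Measure.integral_compProd h2]
    have h4 := integral_inner_fiberAverage ρ₀ ξ g hβ
    refine Eq.trans (integral_congr_ae ?_) (h4.symm.trans (integral_congr_ae ?_))
    · filter_upwards [hyint'] with ω hω
      exact integral_inner hω (g ω)
    · filter_upwards [hyint] with x hx
      exact (integral_inner hx _).symm
  have hpair' : inner ℝ g ξ = ∫ p, inner ℝ (fiberAverage ρ₀ ξ g p.1) p.1 ∂γ := by
    rw [L2.inner_def, ← integral_inner_fiberAverage ρ₀ ξ g (f := fun x => x) μ.memLp]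
    have hm : AEStronglyMeasurable (fun x => inner ℝ (fiberAverage ρ₀ ξ g x) x) μ.meas :=
      (integrable_inner_of_memLp hζ μ.memLp).1
    have hmp := measurePreserving_fst_of_mem_plans hγ
    have h1 := integral_map (μ := γ) measurable_fst.aemeasurable (by rwa [hmp.map_eq])
    rwa [hmp.map_eq] at h1
  -- The bound `ε₁` for the simple approximations of `ξ` and `g` takes into account that the error in
  -- `g` is paired with `η` and with the second component of `Θ`, which have the same norm.
  set Ynorm := ‖hYm.toLp _‖ with hYnorm
  set ε₁ := min (ε / 2) (ε / (2 * Ynorm + 1)) with hε₁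
  have hY0 : 0 ≤ Ynorm := norm_nonneg _
  have hε₁pos : 0 < ε₁ := by positivity
  have hε₁2 : 2 * ε₁ ≤ ε := by linarith [min_le_left (ε / 2) (ε / (2 * Ynorm + 1))]
  have hε₁Y : ε₁ * (2 * Ynorm) ≤ ε := by
    calc ε₁ * (2 * Ynorm) ≤ ε / (2 * Ynorm + 1) * (2 * Ynorm + 1) := by
          gcongr
          · exact min_le_right _ _
          · linarith
      _ = ε := by field_simp
  have hε₁' : ENNReal.ofReal ε₁ ≠ 0 := by simpa using hε₁pos
  obtain ⟨a, ha, ha2⟩ := hξ2.exists_simpleFunc_eLpNorm_sub_lt ENNReal.ofNat_ne_top hε₁'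
  obtain ⟨b, hb, hb2⟩ := hg2.exists_simpleFunc_eLpNorm_sub_lt ENNReal.ofNat_ne_top hε₁'
  have hanorm : ‖ξ - ha2.toLp a‖ ≤ ε₁ := by
    have h1 : ξ - ha2.toLp a = (hξ2.sub ha2).toLp _ := by
      rw [MemLp.toLp_sub hξ2, lp_eq_toLp]
    rw [h1, Lp.norm_toLp]
    exact ENNReal.toReal_le_of_le_ofReal hε₁pos.le ha.le
  have hbnorm : ‖g - hb2.toLp b‖ ≤ ε₁ := by
    have h1 : g - hb2.toLp b = (hg2.sub hb2).toLp _ := by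
      rw [MemLp.toLp_sub hg2, lp_eq_toLp]
    rw [h1, Lp.norm_toLp]
    exact ENNReal.toReal_le_of_le_ofReal hε₁pos.le hb.le
  obtain ⟨η, hη, hlaw⟩ := exists_map_prodMk_simpleFunc_eq hρ hΘfst (a.pair b)
  have hm1 : Measurable (fun ω => ((a.pair b) ω, η ω)) := (a.pair b).measurable.prodMk hη
  have hm2 : Measurable (fun p : Euc d × Euc d => ((a.pair b) p.1, p.2)) :=
    ((a.pair b).measurable.comp measurable_fst).prodMk measurable_snd
  -- Expectations of functions of the simple approximations and of `η` can be computed under `Θ`.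
  have htrans : ∀ f : (Euc d × Euc d) × Euc d → ℝ, Measurable f →
      ∫ ω, f ((a ω, b ω), η ω) ∂ρ₀.meas = ∫ p, f ((a p.1, b p.1), p.2) ∂Θ := by
    intro f hf
    have h1 := integral_map hm1.aemeasurable (μ := ρ₀.meas) (f := f) hf.aestronglyMeasurable
    have h2 := integral_map hm2.aemeasurable (μ := Θ) (f := f) hf.aestronglyMeasurable
    rw [hlaw, h2] at h1
    exact h1.symm
  have hηlaw : ρ₀.meas.map η = ν.meas := by
    have h1 := congr_arg (fun m : Measure ((Euc d × Euc d) × Euc d) => m.map Prod.snd) hlaw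
    simp only [Measure.map_map measurable_snd hm1, Measure.map_map measurable_snd hm2] at h1
    exact h1.trans hsnd.map_eq
  have hη2 : MemLp η 2 ρ₀.meas :=
    ν.memLp.comp_measurePreserving ⟨hη, hηlaw⟩
  have haΘ : MemLp (fun p : Euc d × Euc d => a p.1) 2 Θ := ha2.comp_measurePreserving hfst
  have hbΘ : MemLp (fun p : Euc d × Euc d => b p.1) 2 Θ := hb2.comp_measurePreserving hfst
  have hpulla : ‖hξΘ.toLp _ - haΘ.toLp _‖ = ‖ξ - ha2.toLp a‖ := by
    rw [← Lp.norm_compMeasurePreserving (ξ - ha2.toLp a) hfst, map_sub]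
    nth_rw 2 [← lp_eq_toLp ξ]
    rfl
  have hpullb : ‖hgΘ.toLp _ - hbΘ.toLp _‖ = ‖g - hb2.toLp b‖ := by
    rw [← Lp.norm_compMeasurePreserving (g - hb2.toLp b) hfst, map_sub]
    nth_rw 2 [← lp_eq_toLp g]
    rfl
  refine ⟨hη2.toLp η, ?_, ?_, ?_⟩
  · ext1
    rw [push_toLp, hηlaw]
  · have h1 : ‖hη2.toLp η - ha2.toLp a‖ = ‖hYm.toLp _ - haΘ.toLp _‖ := by
      rw [← MemLp.toLp_sub, ← MemLp.toLp_sub, norm_toLp_eq_sqrt, norm_toLp_eq_sqrt]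
      congr 1
      exact htrans (fun q => ‖q.2 - q.1.1‖ ^ 2) (by fun_prop)
    have h2 : ‖hYm.toLp _ - hξΘ.toLp _‖ = planDist γ := by
      rw [← MemLp.toLp_sub, norm_toLp_eq_sqrt, planDist]
      congr 1
      rw [← hΘγ.map_eq, integral_map hΘγ.measurable.aemeasurable
        (by fun_prop : Measurable fun p : Euc d × Euc d => ‖p.2 - p.1‖ ^ 2).aestronglyMeasurable]
      rfl
    have h3 := norm_sub_le_norm_sub_add_norm_sub (hη2.toLp η) (ha2.toLp a) ξ
    have h4 := norm_sub_le_norm_sub_add_norm_sub (hYm.toLp _) (hξΘ.toLp _) (haΘ.toLp _)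
    rw [norm_sub_rev (ha2.toLp a) ξ] at h3
    linarith
  · have h1 : inner ℝ (hb2.toLp b) (hη2.toLp η) = inner ℝ (hbΘ.toLp _) (hYm.toLp _) := by
      rw [inner_toLp, inner_toLp]
      exact htrans (fun q => inner ℝ q.1.2 q.2) (by fun_prop)
    have h2 : ‖hη2.toLp η‖ = Ynorm := by
      rw [hYnorm, norm_toLp_eq_sqrt, norm_toLp_eq_sqrt]
      congr 1
      exact htrans (fun q => ‖q.2‖ ^ 2) (by fun_prop)
    have h3 : ∫ p, inner ℝ (fiberAverage ρ₀ ξ g p.1) (p.2 - p.1) ∂γ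
        = inner ℝ (hgΘ.toLp _) (hYm.toLp _) - inner ℝ g ξ := by
      rw [inner_toLp, hpair, hpair', ← integral_sub (integrable_inner_of_memLp hζγ hγ2)
        (integrable_inner_of_memLp hζγ hγ1)]
      simp_rw [inner_sub_right]
    have h4 : inner ℝ g (hη2.toLp η - ξ)
          - ∫ p, inner ℝ (fiberAverage ρ₀ ξ g p.1) (p.2 - p.1) ∂γ
        = inner ℝ (g - hb2.toLp b) (hη2.toLp η)
          - inner ℝ (hgΘ.toLp _ - hbΘ.toLp _) (hYm.toLp _) := by
      rw [h3, inner_sub_right, inner_sub_left, inner_sub_left, h1]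
      ring
    rw [h4]
    refine (abs_sub _ _).trans ?_
    have h5 := abs_real_inner_le_norm (g - hb2.toLp b) (hη2.toLp η)
    have h6 := abs_real_inner_le_norm (hgΘ.toLp _ - hbΘ.toLp _) (hYm.toLp _)
    rw [h2] at h5
    rw [hpullb, ← hYnorm] at h6
    have h7 : ‖g - hb2.toLp b‖ * Ynorm ≤ ε₁ * Ynorm := by gcongr
    linarith

end Plans

/-! ### Wasserstein gradients and gradients of the lift -/

section Wasserstein

variable {d : ℕ}

/-- Without atoms, the gradient of the lift, averaged over the fibres of `ξ`, is a Wasserstein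
gradient at the law of `ξ`: every plan is almost realized by maps, for which the Fréchet expansion of
the lift is available. -/
theorem isWassersteinGradient_fiberAverage {ρ₀ : P2 d} (hρ : ∀ x, ρ₀.meas {x} = 0)
    {φ : P2 d → ℝ} {ξ : HSpace ρ₀} (hd : DifferentiableAt ℝ (lift φ ρ₀) ξ) :
    IsWassersteinGradient φ (push ρ₀ ξ) (fiberAverage ρ₀ ξ (gradient (lift φ ρ₀) ξ)) := by
  set g := gradient (lift φ ρ₀) ξ with hg
  have key : ∀ ε : ℝ, 0 < ε → ∃ δ : ℝ, 0 < δ ∧ ∀ ν : P2 d, ∀ γ ∈ Plans (push ρ₀ ξ) ν,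
      planDist γ < δ → |φ ν - φ (push ρ₀ ξ)
        - ∫ p, inner ℝ (fiberAverage ρ₀ ξ g p.1) (p.2 - p.1) ∂γ| ≤ ε * planDist γ := by
    intro ε hε
    have hF := hd.hasGradientAt.hasFDerivAt
    rw [hasFDerivAt_iff_isLittleO, Asymptotics.isLittleO_iff] at hF
    obtain ⟨δ, hδ, hF⟩ := Metric.eventually_nhds_iff.1 (hF hε)
    refine ⟨δ, hδ, fun ν γ hγ hγδ => ?_⟩
    have h0 : 0 ≤ planDist γ := Real.sqrt_nonneg _
    have h1 : ∀ e : ℝ, 0 < e → e < δ - planDist γ → |φ ν - φ (push ρ₀ ξ)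
        - ∫ p, inner ℝ (fiberAverage ρ₀ ξ g p.1) (p.2 - p.1) ∂γ|
          ≤ ε * (planDist γ + e) + e := by
      intro e he heδ
      obtain ⟨η, hη, hη1, hη2⟩ := exists_push_eq_of_mem_plans hρ ξ g hγ he
      have h2 := hF (y := η) (by rw [dist_eq_norm]; linarith)
      rw [InnerProductSpace.toDual_apply_apply, Real.norm_eq_abs] at h2
      simp only [lift, hη] at h2
      have h3 : ε * ‖η - ξ‖ ≤ ε * (planDist γ + e) := by gcongr
      have h4 := abs_sub_le (φ ν - φ (push ρ₀ ξ)) (inner ℝ g (η - ξ))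
        (∫ p, inner ℝ (fiberAverage ρ₀ ξ g p.1) (p.2 - p.1) ∂γ)
      have h5 : |φ ν - φ (push ρ₀ ξ) - inner ℝ g (η - ξ)| ≤ ε * ‖η - ξ‖ := h2
      linarith
    have h2 : Tendsto (fun e : ℝ => ε * (planDist γ + e) + e) (𝓝[>] 0)
        (𝓝 (ε * (planDist γ + 0) + 0)) :=
      Tendsto.mono_left (Continuous.tendsto (by fun_prop) 0) nhdsWithin_le_nhds
    rw [add_zero, add_zero] at h2
    refine ge_of_tendsto h2 ?_
    filter_upwards [Ioo_mem_nhdsGT (sub_pos.2 hγδ)] with e he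
    exact h1 e he.1 he.2
  refine ⟨⟨Lp.memLp _, fun ε hε => ?_⟩, ⟨Lp.memLp _, fun ε hε => ?_⟩⟩
  · obtain ⟨δ, hδ, h⟩ := key ε hε
    exact ⟨δ, hδ, fun ν γ hγ hγδ => by linarith [(abs_le.1 (h ν γ hγ hγδ)).1]⟩
  · obtain ⟨δ, hδ, h⟩ := key ε hε
    exact ⟨δ, hδ, fun ν γ hγ hγδ => by linarith [(abs_le.1 (h ν γ hγ hγδ)).2]⟩

/-- A Wasserstein gradient, composed with `ξ`, is the gradient of the lift: test with the plans
induced by the pairs `(ξ, ξ + h)`. -/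
theorem IsWassersteinGradient.hasGradientAt_lift {ρ₀ : P2 d} {φ : P2 d → ℝ} {ξ : HSpace ρ₀}
    {ζ : Euc d → Euc d} (hζ : IsWassersteinGradient φ (push ρ₀ ξ) ζ) :
    HasGradientAt (lift φ ρ₀)
      ((hζ.1.1.comp_measurePreserving (measurePreserving_push ρ₀ ξ)).toLp (ζ ∘ ξ)) ξ := by
  have hm := hζ.1.1.comp_measurePreserving (measurePreserving_push ρ₀ ξ)
  have hplan : ∀ η : HSpace ρ₀, ∃ γ ∈ Plans (push ρ₀ ξ) (push ρ₀ η), planDist γ = ‖η - ξ‖ ∧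
      ∫ p, inner ℝ (ζ p.1) (p.2 - p.1) ∂γ = inner ℝ (hm.toLp (ζ ∘ ξ)) (η - ξ) := by
    intro η
    have hξm : Measurable ξ := (Lp.stronglyMeasurable ξ).measurable
    have hηm : Measurable η := (Lp.stronglyMeasurable η).measurable
    have hpm : Measurable (fun ω => (ξ ω, η ω)) := hξm.prodMk hηm
    set γ := ρ₀.meas.map (fun ω => (ξ ω, η ω)) with hγ
    have hγp : γ ∈ Plans (push ρ₀ ξ) (push ρ₀ η) := by
      constructor
      · rw [Measure.fst, hγ, Measure.map_map measurable_fst hpm]; rfl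
      · rw [Measure.snd, hγ, Measure.map_map measurable_snd hpm]; rfl
    have hsub : η - ξ = ((Lp.memLp η).sub (Lp.memLp ξ)).toLp _ := by
      rw [MemLp.toLp_sub (Lp.memLp η) (Lp.memLp ξ), lp_eq_toLp, lp_eq_toLp]
    have hζγ : MemLp (fun p : Euc d × Euc d => ζ p.1) 2 γ :=
      hζ.1.1.comp_measurePreserving (measurePreserving_fst_of_mem_plans hγp)
    refine ⟨γ, hγp, ?_, ?_⟩
    · rw [hsub, norm_toLp_eq_sqrt, planDist, hγ, integral_map hpm.aemeasurable
        (by fun_prop : Measurable fun p : Euc d × Euc d => ‖p.2 - p.1‖ ^ 2).aestronglyMeasurable]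
      rfl
    · have hmeas : AEStronglyMeasurable
          (fun p : Euc d × Euc d => inner ℝ (ζ p.1) (p.2 - p.1)) γ :=
        hζγ.1.inner (by fun_prop : Measurable
          fun p : Euc d × Euc d => p.2 - p.1).aestronglyMeasurable
      rw [hsub, inner_toLp, hγ, integral_map hpm.aemeasurable hmeas]
      rfl
  rw [hasGradientAt_iff_hasFDerivAt, hasFDerivAt_iff_isLittleO, Asymptotics.isLittleO_iff]
  intro ε hε
  obtain ⟨δ₁, hδ₁, h1⟩ := hζ.1.2 ε hε
  obtain ⟨δ₂, hδ₂, h2⟩ := hζ.2.2 ε hε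
  refine Metric.eventually_nhds_iff.2 ⟨min δ₁ δ₂, lt_min hδ₁ hδ₂, fun η hη => ?_⟩
  obtain ⟨γ, hγ, hd, hi⟩ := hplan η
  rw [dist_eq_norm] at hη
  have h3 := h1 _ γ hγ (by rw [hd]; exact hη.trans_le (min_le_left _ _))
  have h4 := h2 _ γ hγ (by rw [hd]; exact hη.trans_le (min_le_right _ _))
  rw [hd, hi] at h3 h4
  rw [InnerProductSpace.toDual_apply_apply, Real.norm_eq_abs, abs_le, lift, lift]
  constructor <;> linarith

/-- At a point of differentiability of the lift, Wasserstein differentiability is automatic if there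
are no atoms. -/
lemma wassersteinDifferentiableAt_push {ρ₀ : P2 d} {φ : P2 d → ℝ}
    (hd : Differentiable ℝ (lift φ ρ₀))
    (hatom : (∀ x : Euc d, ρ₀.meas {x} = 0) ∨
      ∀ ξ : HSpace ρ₀, WassersteinDifferentiableAt φ (push ρ₀ ξ)) (ξ : HSpace ρ₀) :
    WassersteinDifferentiableAt φ (push ρ₀ ξ) :=
  hatom.elim (fun h => ⟨_, isWassersteinGradient_fiberAverage h (hd ξ)⟩) fun h => h ξ

lemma isWassersteinGradient_wassersteinGradient {φ : P2 d → ℝ} {μ : P2 d}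
    (h : WassersteinDifferentiableAt φ μ) : IsWassersteinGradient φ μ (wassersteinGradient φ μ) := by
  rw [wassersteinGradient, dif_pos h]
  exact h.choose_spec

lemma wassersteinGradient_comp_ae_eq {ρ₀ : P2 d} {φ : P2 d → ℝ} {ξ : HSpace ρ₀}
    (h : WassersteinDifferentiableAt φ (push ρ₀ ξ)) :
    (fun ω => wassersteinGradient φ (push ρ₀ ξ) (ξ ω)) =ᵐ[ρ₀.meas]
      (gradient (lift φ ρ₀) ξ : HSpace ρ₀) := by
  have h1 := (isWassersteinGradient_wassersteinGradient h).hasGradientAt_lift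
  rw [h1.gradient]
  exact (MemLp.coeFn_toLp _).symm

lemma push_idMap (ρ₀ : P2 d) : push ρ₀ (idMap ρ₀) = ρ₀ := by
  ext1
  rw [idMap, push_toLp, Measure.map_id']

end Wasserstein

/-! ### Test functions along curves of maps -/

section TestFunctions

variable {d : ℕ} {ρ₀ : P2 d} {ψ : Euc d → ℝ}

lemma integral_push (ξ : HSpace ρ₀) (hψ : Continuous ψ) :
    ∫ x, ψ x ∂(push ρ₀ ξ).meas = ∫ ω, ψ (ξ ω) ∂ρ₀.meas :=
  integral_map (Lp.aestronglyMeasurable ξ).aemeasurable hψ.aestronglyMeasurable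

lemma integrable_comp_lp (ξ : HSpace ρ₀) (hψ : Continuous ψ) (hs : HasCompactSupport ψ) :
    Integrable (fun ω => ψ (ξ ω)) ρ₀.meas := by
  obtain ⟨C, hC⟩ := hs.exists_bound_of_continuous hψ
  exact Integrable.of_bound (hψ.comp_aestronglyMeasurable (Lp.aestronglyMeasurable ξ)) C
    (Eventually.of_forall fun ω => hC _)

lemma integral_norm_le_norm (v : HSpace ρ₀) : ∫ ω, ‖v ω‖ ∂ρ₀.meas ≤ ‖v‖ := by
  have h1 := eLpNorm_le_eLpNorm_of_exponent_le (μ := ρ₀.meas) one_le_two (Lp.aestronglyMeasurable v)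
  rw [integral_norm_eq_lintegral_enorm (Lp.aestronglyMeasurable v),
    ← eLpNorm_one_eq_lintegral_enorm, Lp.norm_def]
  exact ENNReal.toReal_mono (Lp.eLpNorm_ne_top v) h1

lemma exists_lipschitzWith_of_hasCompactSupport (hψ : ContDiff ℝ 1 ψ) (hs : HasCompactSupport ψ) :
    ∃ K, LipschitzWith K ψ ∧ ∀ x, ‖fderiv ℝ ψ x‖ ≤ K := by
  obtain ⟨C, hC⟩ := (hs.fderiv (𝕜 := ℝ)).exists_bound_of_continuous (hψ.continuous_fderiv one_ne_zero)
  have h0 : 0 ≤ C := (norm_nonneg _).trans (hC 0)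
  refine ⟨⟨C, h0⟩, lipschitzWith_of_nnnorm_fderiv_le (hψ.differentiable one_ne_zero)
    fun x => hC x, hC⟩

lemma abs_integral_push_sub_le {K : NNReal} (hK : LipschitzWith K ψ)
    (hs : HasCompactSupport ψ) (ξ η : HSpace ρ₀) :
    |∫ x, ψ x ∂(push ρ₀ ξ).meas - ∫ x, ψ x ∂(push ρ₀ η).meas| ≤ K * ‖ξ - η‖ := by
  have hc := hK.continuous
  rw [integral_push ξ hc, integral_push η hc,
    ← integral_sub (integrable_comp_lp ξ hc hs) (integrable_comp_lp η hc hs)]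
  refine (abs_integral_le_integral_abs).trans ?_
  have hint : Integrable (fun ω => ‖(ξ - η : HSpace ρ₀) ω‖) ρ₀.meas :=
    ((Lp.memLp (ξ - η)).integrable one_le_two).norm
  calc ∫ ω, |ψ (ξ ω) - ψ (η ω)| ∂ρ₀.meas ≤ ∫ ω, K * ‖(ξ - η : HSpace ρ₀) ω‖ ∂ρ₀.meas := by
        refine integral_mono_ae
          ((integrable_comp_lp ξ hc hs).sub (integrable_comp_lp η hc hs)).abs (hint.const_mul _) ?_
        filter_upwards [Lp.coeFn_sub ξ η] with ω hω
        rw [hω, Pi.sub_apply, ← dist_eq_norm, ← Real.dist_eq]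
        exact hK.dist_le_mul _ _
    _ ≤ K * ‖ξ - η‖ := by
        rw [integral_const_mul]
        gcongr
        exact integral_norm_le_norm _

/-- Differentiation under the integral sign along a line of maps. -/
lemma hasDerivAt_integral_push_line (hψ : ContDiff ℝ 1 ψ) (hs : HasCompactSupport ψ)
    (ξ v : HSpace ρ₀) (t : ℝ) :
    HasDerivAt (fun s : ℝ => ∫ x, ψ x ∂(push ρ₀ (ξ + (s - t) • v)).meas)
      (∫ ω, fderiv ℝ ψ (ξ ω) (v ω) ∂ρ₀.meas) t := by
  obtain ⟨K, hK, hK'⟩ := exists_lipschitzWith_of_hasCompactSupport hψ hs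
  have hc := hψ.continuous
  have hvint : Integrable (fun ω => ‖v ω‖) ρ₀.meas :=
    ((Lp.memLp v).integrable one_le_two).norm
  have hline : ∀ s : ℝ, (fun ω => ψ ((ξ + (s - t) • v : HSpace ρ₀) ω))
      =ᵐ[ρ₀.meas] fun ω => ψ (ξ ω + (s - t) • v ω) := by
    intro s
    filter_upwards [Lp.coeFn_add ξ ((s - t) • v), Lp.coeFn_smul (s - t) v] with ω h1 h2
    rw [h1, Pi.add_apply, h2, Pi.smul_apply]
  have hmeas : ∀ s : ℝ, AEStronglyMeasurable (fun ω => ψ (ξ ω + (s - t) • v ω)) ρ₀.meas :=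
    fun s => hc.comp_aestronglyMeasurable
      ((Lp.aestronglyMeasurable ξ).add ((Lp.aestronglyMeasurable v).fun_const_smul (s - t)))
  have hξc : ∀ s : ℝ, ∀ ω, HasDerivAt (fun s : ℝ => ψ (ξ ω + (s - t) • v ω))
      (fderiv ℝ ψ (ξ ω + (s - t) • v ω) (v ω)) s := by
    intro s ω
    have h1 : HasDerivAt (fun s : ℝ => ξ ω + (s - t) • v ω) (v ω) s := by
      simpa using (((hasDerivAt_id s).sub_const t).smul_const (v ω)).const_add (ξ ω)
    exact ((hψ.differentiable one_ne_zero _).hasFDerivAt).comp_hasDerivAt s h1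
  have hFm : AEStronglyMeasurable
      (fun ω => fderiv ℝ ψ (ξ ω + (t - t) • v ω) (v ω)) ρ₀.meas := by
    have h1 : Continuous (fun q : Euc d × Euc d => fderiv ℝ ψ (q.1 + (t - t) • q.2) q.2) :=
      ((hψ.continuous_fderiv one_ne_zero).comp (by fun_prop)).clm_apply continuous_snd
    exact h1.comp_aestronglyMeasurable
      ((Lp.aestronglyMeasurable ξ).prodMk (Lp.aestronglyMeasurable v))
  have h := (hasDerivAt_integral_of_dominated_loc_of_deriv_le (μ := ρ₀.meas) (𝕜 := ℝ) (x₀ := t)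
    (s := univ) (F := fun s ω => ψ (ξ ω + (s - t) • v ω))
    (F' := fun s ω => fderiv ℝ ψ (ξ ω + (s - t) • v ω) (v ω)) (bound := fun ω => K * ‖v ω‖)
    univ_mem (Eventually.of_forall hmeas)
    ((integrable_comp_lp _ hc hs).congr (hline t)) hFm
    (Eventually.of_forall fun ω s _ =>
      ((fderiv ℝ ψ _).le_opNorm _).trans (by gcongr; exact hK' _))
    (hvint.const_mul _) (Eventually.of_forall fun ω s _ => hξc s ω)).2
  simp only [sub_self, zero_smul, add_zero] at h
  refine h.congr_of_eventuallyEq (Eventually.of_forall fun s => ?_)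
  simp only
  rw [integral_push _ hc]
  exact integral_congr_ae (hline s)

/-- Chain rule for test functionals along a differentiable curve of maps. They are Lipschitz, hence
the curve may be replaced by its tangent line. -/
lemma hasDerivAt_integral_push (hψ : ContDiff ℝ 1 ψ) (hs : HasCompactSupport ψ)
    {X : ℝ → HSpace ρ₀} {v : HSpace ρ₀} {t : ℝ} (hX : HasDerivAt X v t) :
    HasDerivAt (fun s : ℝ => ∫ x, ψ x ∂(push ρ₀ (X s)).meas)
      (∫ ω, fderiv ℝ ψ (X t ω) (v ω) ∂ρ₀.meas) t := by
  obtain ⟨K, hK, -⟩ := exists_lipschitzWith_of_hasCompactSupport hψ hs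
  have h1 := hasDerivAt_integral_push_line hψ hs (X t) v t
  have h2 : HasDerivAt (fun s : ℝ => ∫ x, ψ x ∂(push ρ₀ (X s)).meas
      - ∫ x, ψ x ∂(push ρ₀ (X t + (s - t) • v)).meas) 0 t := by
    rw [hasDerivAt_iff_isLittleO] at hX ⊢
    refine Asymptotics.IsBigO.trans_isLittleO (Asymptotics.IsBigO.of_bound (K : ℝ)
      (Eventually.of_forall fun s => ?_)) hX
    have := abs_integral_push_sub_le hK hs (X s) (X t + (s - t) • v)
    simpa [sub_sub] using this
  simpa [Pi.add_def] using h2.add h1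

end TestFunctions

end TrapezoidFlow

/-! ### The limit flow and the continuity equation -/

open TrapezoidFlow in
theorem theorem5p16 (d : ℕ) (ρ₀ : TrapezoidFlow.P2 d) (φ : TrapezoidFlow.P2 d → ℝ) (lam : ℝ)
    (hdiff : Differentiable ℝ (TrapezoidFlow.lift φ ρ₀))
    (hconv : StrongConvexOn univ lam (TrapezoidFlow.lift φ ρ₀))
    (hbdd : BddBelow (range (TrapezoidFlow.lift φ ρ₀)))
    (hatom : (∀ x : TrapezoidFlow.Euc d, ρ₀.meas {x} = 0) ∨ ∀ ξ : TrapezoidFlow.HSpace ρ₀,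
      TrapezoidFlow.WassersteinDifferentiableAt φ (TrapezoidFlow.push ρ₀ ξ))
    (Xτ : ℝ → ℕ → TrapezoidFlow.HSpace ρ₀)
    (hscheme : ∀ τ : ℝ, 0 < τ → 0 < lam / 2 + 1 / τ →
      TrapezoidFlow.IsTrapezoidalScheme φ ρ₀ τ (Xτ τ))
    (hinit : Tendsto (fun τ : ℝ => ‖Xτ τ 0 - TrapezoidFlow.idMap ρ₀‖) (𝓝[>] 0) (𝓝 0))
    (hgrad : ∃ C : ℝ, ∀ τ : ℝ, 0 < τ → 0 < lam / 2 + 1 / τ →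
      ‖gradient (TrapezoidFlow.lift φ ρ₀) (Xτ τ 0)‖ ≤ C) :
    ∃ X : ℝ → TrapezoidFlow.HSpace ρ₀,
      (∀ T : ℝ, 0 < T →
        TendstoUniformlyOn (fun (τ : ℝ) (t : ℝ) => TrapezoidFlow.pcInterp τ (Xτ τ) t) X
          (𝓝[>] 0) (Icc 0 T)) ∧
      (∀ t : ℝ, 0 ≤ t →
        TrapezoidFlow.WassersteinDifferentiableAt φ (TrapezoidFlow.push ρ₀ (X t))) ∧
      TrapezoidFlow.IsWeakSolution (fun t : ℝ => TrapezoidFlow.push ρ₀ (X t))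
        (fun (t : ℝ) (x : TrapezoidFlow.Euc d) =>
          -TrapezoidFlow.wassersteinGradient φ (TrapezoidFlow.push ρ₀ (X t)) x) ρ₀ := by
  set A := gradient (lift φ ρ₀) with hA
  have hAc : Continuous A := continuous_gradient_of_strongConvexOn hdiff hconv
  have hW := wassersteinDifferentiableAt_push hdiff hatom
  -- The step size restriction is void for small steps, also when `lam` is negative.
  have hsmall : ∀ᶠ τ in 𝓝[>] (0 : ℝ), 0 < τ ∧ 0 < lam / 2 + 1 / τ := by
    have h1 : Tendsto (fun τ : ℝ => lam / 2 + 1 / τ) (𝓝[>] 0) atTop := by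
      simpa only [one_div] using tendsto_atTop_add_const_left _ (lam / 2) tendsto_inv_nhdsGT_zero
    filter_upwards [self_mem_nhdsWithin, h1.eventually_gt_atTop 0] with τ h2 h3
    exact ⟨h2, h3⟩
  obtain ⟨C, hC⟩ := hgrad
  obtain ⟨X, hX0, hunif, hLip, hder⟩ := exists_flow_of_isCrankNicolson (A := A) (abs_nonneg lam)
    (neg_mul_sq_le_inner_gradient_sub hdiff hconv) hAc (x₀ := idMap ρ₀) (x := Xτ) (C := C)
    (hsmall.mono fun τ h n => eq_sub_of_isMinOn_trapezoidal hdiff h.1 (hscheme τ h.1 h.2 n))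
    (tendsto_iff_norm_sub_tendsto_zero.2 hinit) (hsmall.mono fun τ h => hC τ h.1 h.2)
  have hvae : ∀ t, (fun ω => wassersteinGradient φ (push ρ₀ (X t)) (X t ω)) =ᵐ[ρ₀.meas]
      A (X t) := fun t => wassersteinGradient_comp_ae_eq (hW (X t))
  have hL2 : ∀ t, MemLp (wassersteinGradient φ (push ρ₀ (X t))) 2 (push ρ₀ (X t)).meas :=
    fun t => (isWassersteinGradient_wassersteinGradient (hW (X t))).1.1
  refine ⟨X, fun T _ => hunif T, fun t _ => hW (X t), ⟨?_, ?_, fun T _ => ?_, ?_, ?_⟩⟩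
  · simp only [hX0, push_idMap]
  · exact Eventually.of_forall fun t => ((hL2 t).integrable one_le_two).neg
  · -- The `L¹` norm of the velocity depends continuously on time.
    have h1 : ∀ t, ∫ x, ‖-wassersteinGradient φ (push ρ₀ (X t)) x‖ ∂(push ρ₀ (X t)).meas
        = ∫ ω, ‖A (X t) ω‖ ∂ρ₀.meas := by
      intro t
      simp only [norm_neg]
      have h2 := integral_map (Lp.aestronglyMeasurable (X t)).aemeasurable (hL2 t).1.norm
      refine Eq.trans h2 (integral_congr_ae ?_)
      filter_upwards [hvae t] with ω hω
      rw [hω]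
    simp only [h1]
    have hLipN : LipschitzWith 1 (fun v : HSpace ρ₀ => ∫ ω, ‖v ω‖ ∂ρ₀.meas) := by
      refine LipschitzWith.of_le_add fun v w => ?_
      have hv := ((Lp.memLp v).integrable one_le_two).norm
      have hw := ((Lp.memLp w).integrable one_le_two).norm
      have hvw := ((Lp.memLp (v - w)).integrable one_le_two).norm
      have h2 : ∫ ω, ‖v ω‖ ∂ρ₀.meas
          ≤ ∫ ω, ‖w ω‖ + ‖(v - w : HSpace ρ₀) ω‖ ∂ρ₀.meas := by
        refine integral_mono_ae hv (hw.add hvw) ?_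
        filter_upwards [Lp.coeFn_sub v w] with ω hω
        rw [hω, Pi.sub_apply]
        exact norm_le_insert' _ _
      rw [integral_add hw hvw] at h2
      rw [dist_eq_norm]
      linarith [integral_norm_le_norm (v - w)]
    have hcont : ContinuousOn (fun t => ∫ ω, ‖A (X t) ω‖ ∂ρ₀.meas) (Icc 0 T) := by
      obtain ⟨K, hK⟩ := hLip T
      exact (hLipN.continuous.comp hAc).comp_continuousOn hK.continuousOn
    exact (hcont.integrableOn_Icc).mono_set Ioc_subset_Icc_self
  · intro ψ hψ hs T hT
    obtain ⟨K, hK, -⟩ := exists_lipschitzWith_of_hasCompactSupport hψ hs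
    obtain ⟨K', hK'⟩ := hLip T
    refine LipschitzOnWith.absolutelyContinuousOnInterval (K := K * K') ?_
    rw [uIcc_of_le hT.le]
    refine LipschitzOnWith.of_dist_le_mul fun a ha b hb => ?_
    rw [Real.dist_eq]
    refine (abs_integral_push_sub_le hK hs (X a) (X b)).trans ?_
    rw [NNReal.coe_mul, mul_assoc, ← dist_eq_norm]
    gcongr
    exact hK'.dist_le_mul a ha b hb
  · intro ψ hψ hs
    refine (ae_restrict_iff' measurableSet_Ioi).2 (Eventually.of_forall fun t ht => ?_)
    have h1 := hasDerivAt_integral_push hψ hs (hder t ht)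
    convert h1 using 1
    have hmeas : AEStronglyMeasurable (fun x => inner ℝ (gradient ψ x)
        (-wassersteinGradient φ (push ρ₀ (X t)) x)) (push ρ₀ (X t)).meas := by
      refine AEStronglyMeasurable.inner ?_ (hL2 t).1.neg
      exact ((InnerProductSpace.toDual ℝ (Euc d)).symm.continuous.comp
        (hψ.continuous_fderiv one_ne_zero)).aestronglyMeasurable
    refine Eq.trans (integral_map (Lp.aestronglyMeasurable (X t)).aemeasurable hmeas)
      (integral_congr_ae ?_)
    filter_upwards [hvae t, Lp.coeFn_neg (A (X t))] with ω h2 h3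
    rw [h2, h3, Pi.neg_apply, gradient, InnerProductSpace.toDual_symm_apply]
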